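/- Let $\mathbb F=\mathbb C(q^{1/2})$ with $q^{1/2}$ an indeterminate, $[m]=\frac{q^m-q^{-m}}{q-q^{-1}}$, $\mathsf q=q^2$, $[m]_{\mathsf q}=\frac{\mathsf q^m-1}{\mathsf q-1}$, $[n]_{\mathsf q}!=[n]_{\mathsf q}\cdots[1]_{\mathsf q}$. Let $K(1)=\mathrm{Sym}(a(-r):r\ge 1)$ be the level one Fock space, on which $a(-r)$ acts by multiplication and $a(r)$ by the derivation with $[a(r),a(-s)]=\delta_{rs}\frac{[2r][r]}{r}$ ($r,s\geq 1$). Let $\alpha$ be the simple root of $\mathfrak{sl}_2$, $\lambda_1=\alpha/2$, $(\alpha,\alpha)=2$, and let $L_i$ ($i=0,1$) be the space $K(1)\otimes\bigoplus_{k\in\mathbb Z}\mathbb F e^{k\alpha}e^{i\lambda_1}$ (the Frenkel–Jing realization of the level one integrable highest weight $U_q(\widehat{\mathfrak{sl}}_2)$-module with highest weight $\Lambda_i$). Put $z^{\partial_\beta}e^{\gamma}=z^{(\beta,\gamma)}e^\gamma$ and $e^{\lambda_1}e^{k\alpha}=(-1)^k e^{k\alpha}e^{\lambda_1}$. Let $$x(z)=\exp\Big(\sum_{r\ge1}\tfrac{q^{-r/2}}{[r]}a(-r)z^r\Big)\exp\Big(-\sum_{r\ge1}\tfrac{q^{-r/2}}{[r]}a(r)z^{-r}\Big)\otimes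 e^{\alpha}z^{\partial_\alpha}\in\mathrm{Hom}(L_i,L_i((z)))$$ be the Frenkel–Jing operator and $$\mathcal Y(z)=\exp\Big(\sum_{r\ge1}\tfrac{q^{r/2}}{[2r]}a(-r)z^r\Big)\exp\Big(-\sum_{r\ge1}\tfrac{q^{r/2}}{[2r]}a(r)z^{-r}\Big)\otimes e^{\lambda_1}z^{\partial_{\lambda_1}}\in\mathrm{Hom}(L_0,L_1((z)))$$ Koyama's operator. For operators $a(z)\in\mathrm{Hom}(L,L((z)))$ and $b(z)\in\mathrm{Hom}(K,L((z)))$ such that $a(z_1)b(z_2)\in\mathrm{Hom}(K,L((z_1,z_2)))$ put $a(z)_rb(z)=0$ for $r\ge0$ and $$a(z)_{r}b(z)=\frac{1}{[n]_{\mathsf q}!}\,a^{[n]}(z)\,b(z\mathsf q^{n})\qquad\text{for } r=-n-1<0,$$ where $a^{[n]}$ is the $n$-th iterate of the $\mathsf q$-derivation $a(z)\mapsto\frac{a(z\mathsf q)-a(z)}{z(\mathsf q-1)}$. With the vertex operator map $Y(a(z),z_0)b(z)=\sum_r a(z)_rb(z)z_0^{-r-1}$, let $\langle x(z)\rangle$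 be the smallest nonlocal $\mathsf q$-vertex algebra of operators on $L_1$ containing $x(z)$, that is, the smallest subspace which contains $x(z)$ and $1$, is closed under all $r$-th products, all of whose finite sequences $(a_1,\dots,a_m)$ satisfy $a_1(z_1)\cdots a_m(z_m)\in\mathrm{Hom}(L_1,L_1((z_1,\dots,z_m)))$, and which satisfies the truncation, vacuum and creation axioms and $\mathsf q$-associativity $$Y(a(z),z_0+z_2)Y(b(z),z_2)c(z)=Y(Y(a(z),z_0)b(z),z_2)c(z),\qquad z_2z_0=\mathsf q z_0z_2,\ z_2z=\mathsf q zz_2,\ z_0z=\mathsf q zz_0.$$ Let $\langle\mathcal Y(z)\rangle\subset\mathrm{Hom}(L_0,L_1((z)))$ be the smallest $\langle x(z)\rangle$-module (with the same products) which contains $\mathcal Y(z)$, and let $W_{1,\mathsf q}$ be the linear span of all $$x(z)_{l_m}\cdots x(z)_{l_1}\mathcal Y(z),\qquad m\ge0,\ l_j\in\mathbb Z,\ l_j\le-1 .$$ **Theorem.** $W_{1,\mathsf q}$ is a subspace of $\langle\mathcal Y(z)\rangle$, and the monomials $$x(z)_{l_m}\cdots x(z)_{l_1}\mathcal Y(z),\qquad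 m\ge0,\quad l_1\le-2,\quad l_r\le-3\ \text{ for } r=2,\dots,m,$$ indexed by the sequences $(l_m,\dots,l_1)$ of integers, form a basis of $W_{1,\mathsf q}$ over $\mathbb F$. -/

import Mathlib

noncomputable section

namespace QVA

/-! ### Quantum calculus with parameter `p` (the underlined `q`) -/

/-- `[m]_p = (p ^ m - 1) / (p - 1)`, `m ∈ ℤ`. -/
def qNum {F : Type*} [Field F] (p : F) (m : ℤ) : F := (p ^ m - 1) / (p - 1)

/-- `[l]_p! = [l]_p [l-1]_p ⋯ [1]_p`. -/
def qFact {F : Type*} [Field F] (p : F) (l : ℕ) : F :=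
  ∏ j ∈ Finset.range l, qNum p ((j : ℤ) + 1)

/-- The Gaussian binomial `[m]_p [m-1]_p ⋯ [m-l+1]_p / [l]_p!`. -/
def qBinom {F : Type*} [Field F] (p : F) (m : ℤ) (l : ℕ) : F :=
  (∏ j ∈ Finset.range l, qNum p (m - j)) / qFact p l

/-! ### The spaces `Hom(K, L((z)))` -/

/-- `Hom(K, L((z)))`, where `L((z))` is the space of Laurent series with coefficients in `L`. -/
abbrev LaurentHom (F : Type*) [Field F] (K L : Type*) [AddCommGroup K] [Module F K]
    [AddCommGroup L] [Module F L] : Type _ :=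
  K →ₗ[F] HahnSeries ℤ L

section General

variable {F : Type*} [Field F] {K L M : Type*} [AddCommGroup K] [Module F K]
  [AddCommGroup L] [Module F L] [AddCommGroup M] [Module F M]

/-- The coefficient `a_n : K → L` of `z ^ n` in `a(z) = ∑ a_n z ^ n`. -/
def mode (a : LaurentHom F K L) (n : ℤ) : K →ₗ[F] L :=
  (HahnSeries.coeff.linearMap (R := F) n).comp a

theorem mode_apply (a : LaurentHom F K L) (n : ℤ) (v : K) : mode a n v = (a v).coeff n := rfl

theorem exists_mode_eq_zero (a : LaurentHom F K L) (v : K) :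
    ∃ N : ℤ, ∀ n < N, mode a n v = 0 := by
  refine ⟨(a v).order, fun n hn => ?_⟩
  exact HahnSeries.coeff_eq_zero_of_lt_order hn

/-- The operator `∑ c_n z ^ n` for a family of coefficients `c_n : K → L` which is truncated
from below on every vector. -/
def ofModes (c : ℤ → K →ₗ[F] L) (h : ∀ v, ∃ N : ℤ, ∀ n < N, c n v = 0) :
    LaurentHom F K L where
  toFun v := HahnSeries.ofSuppBddBelow (fun n => c n v) (by
    obtain ⟨N, hN⟩ := h v
    refine ⟨N, fun n hn => ?_⟩
    by_contra hlt
    exact hn (hN n (not_le.mp hlt)))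
  map_add' v w := by ext n; simp
  map_smul' r v := by ext n; simp

theorem mode_ofModes (c : ℤ → K →ₗ[F] L) (h : ∀ v, ∃ N : ℤ, ∀ n < N, c n v = 0) (n : ℤ) :
    mode (ofModes c h) n = c n := by
  ext v; simp [mode_apply, ofModes]

/-- The sum of a family of linear maps which is finite on every vector. -/
def locFinSum {ι : Type*} (f : ι → K →ₗ[F] L)
    (h : ∀ v, (Function.support fun i => f i v).Finite) : K →ₗ[F] L where
  toFun v := ∑ᶠ i, f i v
  map_add' v w := by
    simp only [map_add]
    exact finsum_add_distrib (h v) (h w)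
  map_smul' r v := by
    simp only [map_smul, RingHom.id_apply]
    exact (smul_finsum' r (h v)).symm

/-- The operator `a(z p ^ k)`. -/
def rescale (p : F) (k : ℕ) (a : LaurentHom F K L) : LaurentHom F K L :=
  ofModes (fun n => p ^ ((k : ℤ) * n) • mode a n) (fun v => by
    obtain ⟨N, hN⟩ := exists_mode_eq_zero a v
    exact ⟨N, fun n hn => by simp [hN n hn]⟩)

/-- The `p`-derivation `(a(z p) - a(z)) / (z (p - 1))`. -/
def qDeriv (p : F) (a : LaurentHom F K L) : LaurentHom F K L :=
  ofModes (fun n => (p - 1)⁻¹ • (p ^ (n + 1) • mode a (n + 1) - mode a (n + 1))) (fun v => by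
    obtain ⟨N, hN⟩ := exists_mode_eq_zero a v
    exact ⟨N - 1, fun n hn => by simp [hN (n + 1) (by omega)]⟩)

/-- The coefficient of `z_1 ^ i_1 ⋯ z_m ^ i_m z ^ n` in `a_1(z_1) ⋯ a_m(z_m) b(z) v`; the word is
the list of the pairs `(a_j(z), i_j)`. -/
def modeWord (b : LaurentHom F K L) : List (LaurentHom F L L × ℤ) → ℤ → K → L
  | [], n, v => mode b n v
  | (a, i) :: w, n, v => mode a i (modeWord b w n v)

/-- The sequence `(a_1(z), …, a_m(z), b(z))` is quasi-commutative, i.e.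
`a_1(z_1) ⋯ a_m(z_m) b(z) ∈ Hom(K, L((z_1, …, z_m, z)))`: on every vector the exponents of all
variables are bounded from below. Here `as = [a_1(z), …, a_m(z)]`. -/
def QuasiCommutative (as : List (LaurentHom F L L)) (b : LaurentHom F K L) : Prop :=
  ∀ v : K, ∃ N : ℤ, ∀ e : List ℤ, e.length = as.length → ∀ n : ℤ,
    (n < N ∨ ∃ i ∈ e, i < N) → modeWord b (as.zip e) n v = 0

theorem QuasiCommutative.pair {a : LaurentHom F L L} {b : LaurentHom F K L}
    (h : QuasiCommutative [a] b) (v : K) :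
    ∃ N : ℤ, ∀ i n : ℤ, (n < N ∨ i < N) → mode a i (mode b n v) = 0 := by
  obtain ⟨N, hN⟩ := h v
  refine ⟨N, fun i n hin => ?_⟩
  have := hN [i] rfl n (by simpa using hin)
  simpa [modeWord] using this

open Classical in
/-- `a(z) b(z) = lim_{z_1, z_2 → z} a(z_1) b(z_2)` for a quasi-commutative pair: the coefficient of
`z ^ n` is the (locally finite) sum of the `a_i b_{n-i}`. For other pairs the product is not
defined, and we return `0`. -/
def mulField (a : LaurentHom F L L) (b : LaurentHom F K L) : LaurentHom F K L :=
  if h : QuasiCommutative [a] b then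
    ofModes
      (fun n => locFinSum (fun i : ℤ => (mode a i).comp (mode b (n - i))) (fun v => by
        obtain ⟨N, hN⟩ := h.pair v
        refine (Set.finite_Icc N (n - N)).subset fun i hi => ?_
        by_contra hcon
        refine hi (hN i (n - i) ?_)
        by_contra hc
        push Not at hc
        exact hcon ⟨hc.2, by omega⟩))
      (fun v => by
        obtain ⟨N, hN⟩ := h.pair v
        refine ⟨N + N, fun n hn => ?_⟩
        change ∑ᶠ i : ℤ, mode a i (mode b (n - i) v) = 0
        have : (fun i : ℤ => mode a i (mode b (n - i) v)) = fun _ => 0 := by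
          funext i
          exact hN i (n - i) (by omega)
        rw [this, finsum_zero])
  else 0

/-- The `r`-th product `a(z)_r b(z)`, which is `0` for `r ≥ 0` and
`a^{[n]}(z) b(z p ^ n) / [n]_p!` for `r = -n-1`, `n ≥ 0`. -/
def prod (p : F) (a : LaurentHom F L L) : ℤ → LaurentHom F K L → LaurentHom F K L
  | Int.ofNat _, _ => 0
  | Int.negSucc n, b => (qFact p n)⁻¹ • mulField ((qDeriv p)^[n] a) (rescale p n b)

variable (F L) in
/-- The identity `1_L`, as an element of `Hom(L, L((z)))`. -/
def idField : LaurentHom F L L := HahnSeries.single.linearMap 0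

/-- Associativity `Y(a, z_0 + z_2) Y(b, z_2) c(z) = Y(Y(a, z_0) b, z_2) c(z)` for noncommuting
variables `z_2 z_0 = p z_0 z_2`, `z_2 z = p z z_2`, `z_0 z = p z z_0`, as the equality of the
coefficients of `z_0 ^ i z_2 ^ j` (both sides have only nonnegative powers, since `r`-th
products vanish for `r ≥ 0`). On the left
`z_2 ^ t (z_0 + z_2) ^ u = ∑_l [u choose l]_p p ^ (t (u - l)) z_0 ^ (u - l) z_2 ^ (t + l)`;
on the right `z_0 ^ i c(z) = c(z p ^ i) z_0 ^ i`. -/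
def QAssociative (p : F) (a b : LaurentHom F L L) (c : LaurentHom F K L) : Prop :=
  ∀ i j : ℕ,
    ∑ l ∈ Finset.range (j + 1),
        (qBinom p ((i : ℤ) + l) l * p ^ ((j - l) * i)) •
          prod p a (Int.negSucc (i + l)) (prod p b (Int.negSucc (j - l)) c) =
      prod p (prod p a (Int.negSucc i) b) (Int.negSucc j) (rescale p i c)

/-- A subspace `V` of `Hom(L, L((z)))` is a nonlocal `p`-vertex algebra, with vacuum vector `1_L`
and vertex operator map `Y(a(z), z_0) b(z) = ∑ a(z)_r b(z) z_0 ^ (-r-1)`. -/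
structure IsNonlocalQVertexAlgebra (p : F) (V : Submodule F (LaurentHom F L L)) : Prop where
  quasiCommutative : ∀ as : List (LaurentHom F L L), (∀ a ∈ as, a ∈ V) → ∀ b ∈ V,
    QuasiCommutative as b
  closed : ∀ a ∈ V, ∀ b ∈ V, ∀ r : ℤ, prod p a r b ∈ V
  truncation : ∀ a ∈ V, ∀ b ∈ V, ∃ N : ℤ, ∀ r ≥ N, prod p a r b = 0
  vacuum_mem : idField F L ∈ V
  vacuum : ∀ b ∈ V, ∀ r : ℤ, prod p (idField F L) r b = if r = -1 then b else 0
  creation_regular : ∀ a ∈ V, ∀ r : ℤ, 0 ≤ r → prod p a r (idField F L) = 0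
  creation : ∀ a ∈ V, prod p a (-1) (idField F L) = a
  associativity : ∀ a ∈ V, ∀ b ∈ V, ∀ c ∈ V, QAssociative p a b c

/-- The smallest nonlocal `p`-vertex algebra `⟨S⟩` containing `S`. -/
def generatedAlgebra (p : F) (S : Set (LaurentHom F L L)) : Submodule F (LaurentHom F L L) :=
  sInf {V | IsNonlocalQVertexAlgebra p V ∧ S ⊆ V}

/-- A subspace `W` of `Hom(K, L((z)))` is a module for the nonlocal `p`-vertex algebra
`V ⊆ Hom(L, L((z)))`, with `Y_W(a(z), z_0) c(z) = ∑ a(z)_r c(z) z_0 ^ (-r-1)`. -/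
structure IsQModule (p : F) (V : Submodule F (LaurentHom F L L))
    (W : Submodule F (LaurentHom F K L)) : Prop where
  quasiCommutative : ∀ as : List (LaurentHom F L L), (∀ a ∈ as, a ∈ V) → ∀ c ∈ W,
    QuasiCommutative as c
  closed : ∀ a ∈ V, ∀ c ∈ W, ∀ r : ℤ, prod p a r c ∈ W
  truncation : ∀ a ∈ V, ∀ c ∈ W, ∃ N : ℤ, ∀ r ≥ N, prod p a r c = 0
  vacuum : ∀ c ∈ W, ∀ r : ℤ, prod p (idField F L) r c = if r = -1 then c else 0
  associativity : ∀ a ∈ V, ∀ b ∈ V, ∀ c ∈ W, QAssociative p a b c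

/-- The smallest `V`-module `⟨y(z)⟩` containing `y(z)`. -/
def generatedModule (p : F) (V : Submodule F (LaurentHom F L L)) (y : LaurentHom F K L) :
    Submodule F (LaurentHom F K L) :=
  sInf {W | IsQModule p V W ∧ y ∈ W}

end General

/-! ### Level one modules for the quantum affine algebra of `sl_2` -/

/-- The ground field `ℂ(q ^ (1/2))`. -/
abbrev QField : Type := RatFunc ℂ

/-- The indeterminate `q ^ (1/2)`. -/
def qHalf : QField := RatFunc.X

/-- `q`. -/
def qq : QField := qHalf ^ 2

/-- The symmetric `q`-integer `[m] = (q ^ m - q ^ (-m)) / (q - q ^ (-1))`. -/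
def qInt (m : ℕ) : QField := (qq ^ m - (qq ^ m)⁻¹) / (qq - qq⁻¹)

/-- The parameter `q ^ 2` of the nonlocal vertex algebra. -/
def qPar : QField := qq ^ 2

/-- `K(1)`, the symmetric algebra on the `a(-r)`, `r ≥ 1`. The variable `X r` is `a(-r)`. -/
abbrev Heis : Type := MvPolynomial ℕ+ QField

/-- `a(-r)`, `r ≥ 1`: multiplication by the variable. -/
def heisNeg (r : ℕ+) : Heis →ₗ[QField] Heis := LinearMap.mulLeft QField (MvPolynomial.X r)

/-- `a(r)`, `r ≥ 1`: the derivation with `[a(r), a(-s)] = δ_{r,s} [2r] [r] / r`. -/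
def heisPos (r : ℕ+) : Heis →ₗ[QField] Heis :=
  (qInt (2 * r) * qInt r / (r : QField)) •
    (MvPolynomial.pderiv (R := QField) r : Derivation QField Heis Heis).toLinearMap

/-- `∑_{r ≥ 1} c_r A_r w ^ r`, a power series with operator coefficients. -/
def opSeries (c : ℕ+ → QField) (A : ℕ+ → Heis →ₗ[QField] Heis) :
    PowerSeries (Module.End QField Heis) :=
  PowerSeries.mk fun n => if h : 0 < n then c ⟨n, h⟩ • A ⟨n, h⟩ else 0

/-- `exp f` for a power series `f` without constant term: the coefficient of `w ^ n` in
`f ^ k` vanishes for `k > n`. -/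
def expSeries (f : PowerSeries (Module.End QField Heis)) :
    PowerSeries (Module.End QField Heis) :=
  PowerSeries.mk fun n =>
    ∑ k ∈ Finset.range (n + 1), (k.factorial : QField)⁻¹ • PowerSeries.coeff n (f ^ k)

/-- The coefficient of `z ^ n` in `exp (∑_{r ≥ 1} c_r a(-r) z ^ r)`, `n ∈ ℤ`. -/
def expNeg (c : ℕ+ → QField) (n : ℤ) : Heis →ₗ[QField] Heis :=
  if 0 ≤ n then PowerSeries.coeff n.toNat (expSeries (opSeries c heisNeg)) else 0

/-- The coefficient of `z ^ (-j)` in `exp (∑_{r ≥ 1} c_r a(r) z ^ (-r))`, `j ∈ ℕ`. -/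
def expPos (c : ℕ+ → QField) (j : ℕ) : Heis →ₗ[QField] Heis :=
  PowerSeries.coeff j (expSeries (opSeries c heisPos))

/-- Polynomials of weight at most `d`, where `a(-r)` has weight `r`. -/
def weightLE (d : ℤ) : Submodule QField Heis :=
  Submodule.span QField {f | ∃ s : ℕ+ →₀ ℕ,
    ((Finsupp.weight (fun r : ℕ+ => (r : ℕ)) s : ℕ) : ℤ) ≤ d ∧ f = MvPolynomial.monomial s 1}

theorem weightLE_mono {d e : ℤ} (h : d ≤ e) : weightLE d ≤ weightLE e := by
  refine Submodule.span_mono ?_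
  rintro f ⟨s, hs, rfl⟩
  exact ⟨s, hs.trans h, rfl⟩

theorem weightLE_neg {d : ℤ} (h : d < 0) {f : Heis} (hf : f ∈ weightLE d) : f = 0 := by
  have : {f : Heis | ∃ s : ℕ+ →₀ ℕ,
      ((Finsupp.weight (fun r : ℕ+ => (r : ℕ)) s : ℕ) : ℤ) ≤ d ∧
        f = MvPolynomial.monomial s 1} = ∅ := by
    ext g
    simp only [Set.mem_ofPred_eq, Set.mem_empty_iff_false, iff_false]
    rintro ⟨s, hs, -⟩
    omega
  rw [weightLE, this, Submodule.span_empty] at hf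
  simpa using hf

theorem exists_mem_weightLE (f : Heis) : ∃ d : ℤ, f ∈ weightLE d := by
  induction f using MvPolynomial.induction_on' with
  | monomial s a =>
    refine ⟨((Finsupp.weight (fun r : ℕ+ => (r : ℕ)) s : ℕ) : ℤ), ?_⟩
    have : MvPolynomial.monomial s a = a • (MvPolynomial.monomial s 1 : Heis) := by
      simp [MvPolynomial.smul_monomial]
    rw [this]
    exact Submodule.smul_mem _ _ (Submodule.subset_span ⟨s, le_rfl, rfl⟩)
  | add f g hf hg =>
    obtain ⟨d, hd⟩ := hf
    obtain ⟨e, he⟩ := hg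
    exact ⟨max d e, Submodule.add_mem _ (weightLE_mono (le_max_left _ _) hd)
      (weightLE_mono (le_max_right _ _) he)⟩

theorem heisPos_mem (r : ℕ+) {d : ℤ} {f : Heis} (hf : f ∈ weightLE d) :
    heisPos r f ∈ weightLE (d - r) := by
  induction hf using Submodule.span_induction with
  | mem g hg =>
    obtain ⟨s, hs, rfl⟩ := hg
    simp only [heisPos, LinearMap.smul_apply]
    refine Submodule.smul_mem _ _ ?_
    change MvPolynomial.pderiv r (MvPolynomial.monomial s 1) ∈ _
    rw [MvPolynomial.pderiv_monomial]
    by_cases h0 : s r = 0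
    · simp [h0]
    · have hle : Finsupp.single r 1 ≤ s := by
        rw [Finsupp.single_le_iff]; omega
      have hw := congrArg (Finsupp.weight (fun r : ℕ+ => (r : ℕ))) (tsub_add_cancel_of_le hle)
      rw [map_add, Finsupp.weight_single] at hw
      have : MvPolynomial.monomial (s - Finsupp.single r 1) (1 * (s r : QField)) =
          (s r : QField) • (MvPolynomial.monomial (s - Finsupp.single r 1) 1 : Heis) := by
        simp [MvPolynomial.smul_monomial]
      rw [this]
      refine Submodule.smul_mem _ _ (Submodule.subset_span ⟨_, ?_, rfl⟩)
      simp only [smul_eq_mul, one_mul] at hw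
      omega
  | zero => simp
  | add g h _ _ ihg ihh => rw [map_add]; exact Submodule.add_mem _ ihg ihh
  | smul a g _ ih => rw [map_smul]; exact Submodule.smul_mem _ _ ih

theorem coeff_pow_opSeries_mem (c : ℕ+ → QField) (k n : ℕ) {d : ℤ} {f : Heis}
    (hf : f ∈ weightLE d) :
    PowerSeries.coeff n (opSeries c heisPos ^ k) f ∈ weightLE (d - n) := by
  induction k generalizing n d f with
  | zero =>
    rw [pow_zero, PowerSeries.coeff_one]
    split_ifs with h
    · subst h; simpa using hf
    · simp
  | succ k ih =>
    rw [pow_succ, PowerSeries.coeff_mul, LinearMap.sum_apply]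
    refine Submodule.sum_mem _ fun x hx => ?_
    have hxn := Finset.HasAntidiagonal.mem_antidiagonal.mp hx
    rw [Module.End.mul_apply]
    have h1 : PowerSeries.coeff x.2 (opSeries c heisPos) f ∈ weightLE (d - x.2) := by
      rw [opSeries, PowerSeries.coeff_mk]
      split_ifs with h
      · exact Submodule.smul_mem _ _ (heisPos_mem ⟨x.2, h⟩ hf)
      · simp
    have h2 := ih x.1 h1
    have : d - (n : ℤ) = d - x.2 - x.1 := by omega
    rwa [this]

theorem exists_expPos_eq_zero (c : ℕ+ → QField) (f : Heis) :
    ∃ J : ℕ, ∀ j ≥ J, expPos c j f = 0 := by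
  obtain ⟨d, hd⟩ := exists_mem_weightLE f
  refine ⟨d.toNat + 1, fun j hj => ?_⟩
  rw [expPos, expSeries, PowerSeries.coeff_mk, LinearMap.sum_apply]
  refine Finset.sum_eq_zero fun k _ => ?_
  rw [LinearMap.smul_apply,
    weightLE_neg (by omega) (coeff_pow_opSeries_mem c k j hd), smul_zero]

/-- The coefficient of `z ^ n` in the normally ordered product
`exp (∑_{r ≥ 1} c_r a(-r) z ^ r) exp (∑_{r ≥ 1} d_r a(r) z ^ (-r))`. -/
def expMode (c d : ℕ+ → QField) (n : ℤ) : Heis →ₗ[QField] Heis :=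
  locFinSum (fun j : ℕ => (expNeg c (n + j)).comp (expPos d j)) (fun v => by
    obtain ⟨J, hJ⟩ := exists_expPos_eq_zero d v
    refine (Set.finite_lt_nat J).subset fun j hj => ?_
    by_contra hc
    exact hj (by simp [hJ j (not_lt.mp hc)]))

theorem exists_expMode_eq_zero (c d : ℕ+ → QField) (v : Heis) :
    ∃ N : ℤ, ∀ n < N, expMode c d n v = 0 := by
  obtain ⟨J, hJ⟩ := exists_expPos_eq_zero d v
  refine ⟨-J, fun n hn => ?_⟩
  change ∑ᶠ j : ℕ, expNeg c (n + j) (expPos d j v) = 0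
  have : (fun j : ℕ => expNeg c (n + j) (expPos d j v)) = fun _ => 0 := by
    funext j
    by_cases hj : J ≤ j
    · simp [hJ j hj]
    · have : ¬ (0 ≤ n + (j : ℤ)) := by omega
      simp [expNeg, this]
  rw [this, finsum_zero]

/-- The spaces `L_0 = K(1) ⊗ ℂ{Q}` and `L_1 = K(1) ⊗ ℂ{Q} e^{λ_1}`: for `i = 0, 1` the function
`Finsupp.single k f` is the vector `f ⊗ e^{k α} e^{i λ_1}` of `L_i`, where `α` is the simple root
and `λ_1 = α / 2`. -/
abbrev FockSpace (_i : Fin 2) : Type := ℤ →₀ Heis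

/-- `exp (∑ c_r a(-r) z ^ r) exp (∑ d_r a(r) z ^ (-r)) ⊗ (e^{k α} e^{i λ_1} ↦
s_k z ^ {m_k} e^{(k + t) α} e^{i' λ_1})`. -/
def vertexOp (i i' : Fin 2) (c d : ℕ+ → QField) (s : ℤ → QField) (m : ℤ → ℤ) (t : ℤ) :
    LaurentHom QField (FockSpace i) (FockSpace i') :=
  Finsupp.lsum QField fun k : ℤ =>
    ofModes (fun n => s k • (Finsupp.lsingle (k + t)).comp (expMode c d (n - m k))) (fun v => by
      obtain ⟨N, hN⟩ := exists_expMode_eq_zero c d v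
      exact ⟨N + m k, fun n hn => by simp [hN (n - m k) (by omega)]⟩)

/-- The Frenkel-Jing operator `x(z) = x^+(z)` on `L_i`:
`exp (∑ q^{-r/2}/[r] a(-r) z^r) exp (- ∑ q^{-r/2}/[r] a(r) z^{-r}) ⊗ e^α z^{∂_α}`, where
`z^{∂_α} e^{k α} e^{i λ_1} = z^{2k+i} e^{k α} e^{i λ_1}`. -/
def frenkelJing (i : Fin 2) : LaurentHom QField (FockSpace i) (FockSpace i) :=
  vertexOp i i (fun r => (qHalf ^ (r : ℕ))⁻¹ / qInt r) (fun r => -((qHalf ^ (r : ℕ))⁻¹ / qInt r))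
    (fun _ => 1) (fun k => 2 * k + ((i : ℕ) : ℤ)) 1

/-- Koyama's operator `𝒴(z) : L_0 → L_1((z))`,
`exp (∑ q^{r/2}/[2r] a(-r) z^r) exp (- ∑ q^{r/2}/[2r] a(r) z^{-r}) ⊗ e^{λ_1} z^{∂_{λ_1}}`, where
`z^{∂_{λ_1}} e^{k α} = z^k e^{k α}`, and `e^{λ_1} e^{k α} = (-1)^k e^{k α} e^{λ_1}` is the sign of
the twisted group algebra, for which `x(z_1) 𝒴(z_2) = 𝒴(z_2) x(z_1)`. -/
def koyama : LaurentHom QField (FockSpace 0) (FockSpace 1) :=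
  vertexOp 0 1 (fun r => qHalf ^ (r : ℕ) / qInt (2 * r)) (fun r => -(qHalf ^ (r : ℕ) / qInt (2 * r)))
    (fun k => (-1) ^ k) (fun k => k) 0

/-- The nonlocal `q²`-vertex algebra `⟨x(z)⟩ ⊆ Hom(L_i, L_i((z)))` of operators on `L_i`. -/
def frenkelJingAlgebra (i : Fin 2) :
    Submodule QField (LaurentHom QField (FockSpace i) (FockSpace i)) :=
  generatedAlgebra qPar {frenkelJing i}

/-- The `⟨x(z)⟩`-module `⟨𝒴(z)⟩ ⊆ Hom(L_0, L_1((z)))`. The operators of `⟨x(z)⟩` are composed with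
operators that take values in `L_1`, so they are considered on `L_1`. -/
def koyamaModule : Submodule QField (LaurentHom QField (FockSpace 0) (FockSpace 1)) :=
  generatedModule qPar (frenkelJingAlgebra 1) koyama

/-- `x(z)_{l_m} ⋯ x(z)_{l_1} 𝒴(z)` for the list `[l_m, …, l_1]`. -/
def koyamaMonomial : List ℤ → LaurentHom QField (FockSpace 0) (FockSpace 1)
  | [] => koyama
  | l :: ls => prod qPar (frenkelJing 1) l (koyamaMonomial ls)

/-- `W_{1,q}`: the span of all `x(z)_{l_m} ⋯ x(z)_{l_1} 𝒴(z)` with `l_j ≤ -1`, `m ≥ 0`. -/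
def principalW1 : Submodule QField (LaurentHom QField (FockSpace 0) (FockSpace 1)) :=
  Submodule.span QField {w | ∃ ls : List ℤ, (∀ l ∈ ls, l ≤ -1) ∧ w = koyamaMonomial ls}

/-- For a list `[l_m, …, l_1]`: `l_1 ≤ -2`, and `l_r ≤ -3` for `r = 2, …, m`. -/
def BasisIndex : List ℤ → Prop
  | [] => True
  | [l] => l ≤ -2
  | l :: l' :: ls => l ≤ -3 ∧ BasisIndex (l' :: ls)

end QVA

end

/-!
The operators that are multiplied here are all evaluated at points `z p ^ k`, where `p = q²`. By the
definition of the `p`-derivation, the product `x(z)_{-n-1} b(z)` is, up to a nonzero factor, the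
`n`-th `p`-difference of the values `x(z p ^ k) b(z p ^ n)`, `k = 0, …, n`. Hence a monomial
`x(z)_{-n_m-1} ⋯ x(z)_{-n_1-1} 𝒴(z)` is `z ^ (-N)` times a linear combination of the operators
`x(z p ^ {s_m}) ⋯ x(z p ^ {s_1}) 𝒴(z p ^ N)` with `N_{j+1} ≤ s_j ≤ N_j`, where
`N_j = n_m + ⋯ + n_j`, `N = N_1` and `N_{m+1} = 0`. These operators are the `pointProduct`s.

*Evaluation.* Commuting annihilation past creation exponentials (`map_C_expSeries_mul`) gives
`x(z) x(w) = (z - w)(z - p⁻¹ w) :x(z) x(w):` and `x(z) 𝒴(w) = (z - w) :x(z) 𝒴(w):`. The contractions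
are polynomials, so all pairs are quasi-commutative, and products at coinciding points are again
vertex operators, multiplied by the value of the contraction (`mulField_vertexOp`). In particular a
`pointProduct` with `s_m ≤ ⋯ ≤ s_1 ≤ N` vanishes unless `s_{j+1} + 2 ≤ s_j` for all `j` and
`s_1 < N`; configurations with these gaps are called separated.

*Independence.* The vectors `exp (∑ c_r a(-r) z ^ r) 1` are eigenvectors of `z⁻¹ a(1)`, with
eigenvalue proportional to `c_1`. For a separated configuration this is, up to normalization,
`∑_j (p ^ {s_j} + p ^ {s_j+1}) + p ^ {N+1}`, in which all exponents are different; so the eigenvalue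
determines the configuration, and the products at separated configurations are independent
(`linearIndependent_configProduct`). The monomial with exponents `n_m, …, n_1` has the leading
configuration `s_m = 0`, `s_j = N_{j+1}`, all other ones having a larger sum of the `s_j`. The
leading configuration determines the `n_j`, and it is separated exactly when `n_1 ≥ 1` and `n_r ≥ 2`
for `r ≥ 2`, so that the corresponding monomials are independent by triangularity.

*Spanning.* The Leibniz rule for `p`-differences (`qDiff_pow_diagonal`), applied to
`x(z) x(z) = 0` and `x(z) x(z p) = 0`, gives two linear relations among the products
`x(z)_{-i-1} x(z)_{-j-1} w(z)` with fixed `i + j`, for every `w(z)` in the span of the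
`pointProduct`s. They express the products with `i = 0, 1` by those with `i ≥ 2`
(`mem_of_relations`). Together with `x(z)_{-1} 𝒴(z) = 0` this reduces every monomial to those of the
basis, by induction on the length: the tail of the monomial is reduced first, then its head.
-/

noncomputable section

namespace QVA

/-! ### The Euler operator on power series and exponentials -/

section Euler

variable {A : Type*} [Ring A]

/-- The Euler operator `w d/dw` on power series with coefficients in a ring that need not be
commutative. -/
def euler (f : PowerSeries A) : PowerSeries A :=
  PowerSeries.mk fun n => n • PowerSeries.coeff n f

@[simp] theorem coeff_euler (f : PowerSeries A) (n : ℕ) :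
    PowerSeries.coeff n (euler f) = n • PowerSeries.coeff n f := by
  simp [euler]

theorem euler_mul (f g : PowerSeries A) : euler (f * g) = euler f * g + f * euler g := by
  ext n
  rw [coeff_euler, map_add, PowerSeries.coeff_mul, PowerSeries.coeff_mul, PowerSeries.coeff_mul,
    Finset.smul_sum, ← Finset.sum_add_distrib]
  refine Finset.sum_congr rfl fun x hx => ?_
  rw [coeff_euler, coeff_euler, ← Finset.HasAntidiagonal.mem_antidiagonal.mp hx, add_smul,
    smul_mul_assoc, mul_smul_comm]

theorem euler_C (a : A) : euler (PowerSeries.C a) = 0 := by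
  ext n
  rw [coeff_euler, PowerSeries.coeff_C]
  split_ifs with h <;> simp [h]

theorem euler_add (f g : PowerSeries A) : euler (f + g) = euler f + euler g := by
  ext n; simp

theorem euler_sub (f g : PowerSeries A) : euler (f - g) = euler f - euler g := by
  ext n; simp [smul_sub]

theorem euler_pow_succ {f : PowerSeries A} (h : Commute f (euler f)) (k : ℕ) :
    euler (f ^ (k + 1)) = (k + 1) • (euler f * f ^ k) := by
  induction k with
  | zero => simp
  | succ k ih =>
    rw [pow_succ, euler_mul, ih, (h.pow_left (k + 1)).eq, smul_mul_assoc, mul_assoc, ← pow_succ,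
      ← succ_nsmul]

theorem coeff_pow_eq_zero_of_lt {f : PowerSeries A} (h : PowerSeries.coeff 0 f = 0) {n k : ℕ}
    (hnk : n < k) : PowerSeries.coeff n (f ^ k) = 0 := by
  induction k generalizing n with
  | zero => omega
  | succ k ih =>
    rw [pow_succ, PowerSeries.coeff_mul]
    refine Finset.sum_eq_zero fun x hx => ?_
    have hx' := Finset.HasAntidiagonal.mem_antidiagonal.mp hx
    by_cases h2 : x.2 = 0
    · rw [h2, h, mul_zero]
    · rw [ih (by omega), zero_mul]

/-- The differential equation `w E' = G E` with `G(0) = 0` has at most one solution with given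
constant term. -/
theorem eq_of_euler_eq [IsAddTorsionFree A] {G E E' : PowerSeries A}
    (hG : PowerSeries.coeff 0 G = 0) (h0 : PowerSeries.coeff 0 E = PowerSeries.coeff 0 E')
    (hE : euler E = G * E) (hE' : euler E' = G * E') : E = E' := by
  ext n
  induction n using Nat.strong_induction_on with
  | _ n ih =>
    by_cases hn : n = 0
    · rw [hn, h0]
    · have h1 := congrArg (PowerSeries.coeff n) hE
      have h2 := congrArg (PowerSeries.coeff n) hE'
      rw [coeff_euler, PowerSeries.coeff_mul] at h1 h2
      refine nsmul_right_injective hn ?_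
      simp only
      rw [h1, h2]
      refine Finset.sum_congr rfl fun x hx => ?_
      have hx' := Finset.HasAntidiagonal.mem_antidiagonal.mp hx
      by_cases hx1 : x.1 = 0
      · rw [hx1, hG, zero_mul, zero_mul]
      · rw [ih x.2 (by omega)]

/-- Power series commute as soon as their coefficients do. -/
theorem commute_of_coeff {f g : PowerSeries A}
    (h : ∀ i j, Commute (PowerSeries.coeff i f) (PowerSeries.coeff j g)) : Commute f g := by
  change f * g = g * f
  ext n
  rw [PowerSeries.coeff_mul, PowerSeries.coeff_mul, ← Finset.Nat.sum_antidiagonal_swap]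
  exact Finset.sum_congr rfl fun x _ => (h _ _).eq

theorem commute_coeff_pow {f : PowerSeries A} {a : A}
    (h : ∀ i, Commute a (PowerSeries.coeff i f)) (k n : ℕ) :
    Commute a (PowerSeries.coeff n (f ^ k)) := by
  have h1 : Commute (PowerSeries.C a) f := commute_of_coeff fun i j => by
    rw [PowerSeries.coeff_C]
    split_ifs
    · exact h j
    · exact Commute.zero_left _
  have h2 := congrArg (PowerSeries.coeff n) (h1.pow_right k).eq
  rwa [PowerSeries.coeff_C_mul, PowerSeries.coeff_mul_C] at h2

end Euler

section Exp

variable {f g : PowerSeries (Module.End QField Heis)}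

instance : IsAddTorsionFree (Module.End QField Heis) := IsAddTorsionFree.of_module_rat _

theorem coeff_zero_expSeries : PowerSeries.coeff 0 (expSeries f) = 1 := by
  simp [expSeries]

theorem commute_coeff_expSeries {a : Module.End QField Heis}
    (h : ∀ i, Commute a (PowerSeries.coeff i f)) (n : ℕ) :
    Commute a (PowerSeries.coeff n (expSeries f)) := by
  rw [expSeries, PowerSeries.coeff_mk]
  exact Commute.sum_right _ _ _ fun k _ => (commute_coeff_pow h k n).smul_right _

/-- The coefficients of `f` commute with each other, and `f` has no constant term. -/
structure Exponentiable (f : PowerSeries (Module.End QField Heis)) : Prop where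
  coeff_zero : PowerSeries.coeff 0 f = 0
  commute : ∀ i j, Commute (PowerSeries.coeff i f) (PowerSeries.coeff j f)

/-- `w d/dw exp(f) = (w d/dw f) exp(f)`; this needs the commutativity of the coefficients of `f`. -/
theorem Exponentiable.euler_expSeries (hf : Exponentiable f) :
    euler (expSeries f) = euler f * expSeries f := by
  have hc : Commute f (euler f) := commute_of_coeff fun i j => by
    rw [coeff_euler]; exact (hf.commute i j).smul_right _
  ext1 n
  have key : ∀ k, ((k + 1).factorial : QField)⁻¹ • (n • PowerSeries.coeff n (f ^ (k + 1))) =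
      ∑ x ∈ Finset.HasAntidiagonal.antidiagonal n, PowerSeries.coeff x.1 (euler f) *
        ((k.factorial : QField)⁻¹ • PowerSeries.coeff x.2 (f ^ k)) := by
    intro k
    rw [← coeff_euler, euler_pow_succ hc, map_nsmul, PowerSeries.coeff_mul,
      ← Nat.cast_smul_eq_nsmul QField, smul_smul, Finset.smul_sum]
    refine Finset.sum_congr rfl fun x _ => ?_
    rw [mul_smul_comm]
    congr 1
    rw [Nat.factorial_succ, Nat.cast_mul]
    have h1 : ((k + 1 : ℕ) : QField) ≠ 0 := Nat.cast_ne_zero.mpr (Nat.succ_ne_zero k)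
    have h2 : (k.factorial : QField) ≠ 0 := Nat.cast_ne_zero.mpr (Nat.factorial_ne_zero k)
    field_simp
  rw [coeff_euler, PowerSeries.coeff_mul, expSeries, PowerSeries.coeff_mk, Finset.sum_range_succ',
    smul_add, Finset.smul_sum]
  simp_rw [smul_comm n]
  simp_rw [key]
  have h0 : n • PowerSeries.coeff n (f ^ 0) = 0 := by
    by_cases hn : n = 0 <;> simp [hn, PowerSeries.coeff_one]
  rw [h0, smul_zero, add_zero, Finset.sum_comm]
  refine Finset.sum_congr rfl fun x hx => ?_
  have hx' := Finset.HasAntidiagonal.mem_antidiagonal.mp hx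
  rw [← Finset.mul_sum, PowerSeries.coeff_mk]
  by_cases hx1 : x.1 = 0
  · simp [hx1]
  · congr 1
    symm
    refine Finset.sum_subset (Finset.range_subset_range.mpr (by omega)) fun k _ hk => ?_
    rw [coeff_pow_eq_zero_of_lt hf.coeff_zero (by simpa using hk), smul_zero]

theorem Exponentiable.expSeries_add (hf : Exponentiable f) (hg : Exponentiable g)
    (hfg : ∀ i j, Commute (PowerSeries.coeff i f) (PowerSeries.coeff j g)) :
    expSeries (f + g) = expSeries f * expSeries g := by
  have hadd : Exponentiable (f + g) := by
    refine ⟨by rw [map_add, hf.coeff_zero, hg.coeff_zero, add_zero], fun i j => ?_⟩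
    rw [map_add, map_add]
    exact ((hf.commute i j).add_right (hfg i j)).add_left
      ((hfg j i).symm.add_right (hg.commute i j))
  refine eq_of_euler_eq (G := euler (f + g)) (by simp) ?_ hadd.euler_expSeries ?_
  · simp [PowerSeries.coeff_mul, coeff_zero_expSeries]
  · have hc : Commute (euler g) (expSeries f) := commute_of_coeff fun i j => by
      rw [coeff_euler]
      exact (commute_coeff_expSeries (fun k => (hfg k i).symm) j).smul_left _
    rw [euler_mul, hf.euler_expSeries, hg.euler_expSeries, euler_add, add_mul, mul_assoc,
      ← mul_assoc (expSeries f), ← hc.eq]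
    simp only [mul_assoc]

/-- Rescaling the variable commutes with the exponential. -/
theorem Exponentiable.coeff_expSeries_rescale (hf : Exponentiable f) (b : QField)
    (hg : ∀ n, PowerSeries.coeff n g = b ^ n • PowerSeries.coeff n f) (n : ℕ) :
    PowerSeries.coeff n (expSeries g) = b ^ n • PowerSeries.coeff n (expSeries f) := by
  have hgE : Exponentiable g := by
    refine ⟨by simp [hg, hf.coeff_zero], fun i j => ?_⟩
    rw [hg, hg]
    exact ((hf.commute i j).smul_left _).smul_right _
  have : expSeries g = PowerSeries.mk fun n => b ^ n • PowerSeries.coeff n (expSeries f) := by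
    refine eq_of_euler_eq (G := euler g) (by simp) ?_ hgE.euler_expSeries ?_
    · simp [coeff_zero_expSeries]
    · ext1 n
      have h := congrArg (PowerSeries.coeff n) hf.euler_expSeries
      rw [coeff_euler, PowerSeries.coeff_mul] at h
      rw [coeff_euler, PowerSeries.coeff_mk, smul_comm, h, PowerSeries.coeff_mul, Finset.smul_sum]
      refine Finset.sum_congr rfl fun x hx => ?_
      rw [PowerSeries.coeff_mk, coeff_euler, coeff_euler, hg,
        ← Finset.HasAntidiagonal.mem_antidiagonal.mp hx, pow_add, mul_smul_comm, smul_comm x.1,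
        smul_mul_assoc, smul_mul_assoc, smul_mul_assoc, smul_smul, mul_comm (b ^ x.2)]
  rw [this, PowerSeries.coeff_mk]

end Exp

/-! ### The Heisenberg algebra -/

theorem commute_heisNeg (r s : ℕ+) : Commute (heisNeg r) (heisNeg s) := by
  refine LinearMap.ext fun f => ?_
  simp [heisNeg, mul_left_comm]

theorem commute_heisPos (r s : ℕ+) : Commute (heisPos r) (heisPos s) := by
  have h : ⁅(MvPolynomial.pderiv r : Derivation QField Heis Heis),
      (MvPolynomial.pderiv s : Derivation QField Heis Heis)⁆ = 0 := by
    refine MvPolynomial.derivation_ext fun i => ?_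
    rw [Derivation.commutator_apply]
    simp [MvPolynomial.pderiv_X, Pi.single_apply, apply_ite]
  refine Commute.smul_left (Commute.smul_right (LinearMap.ext fun f => ?_) _) _
  have := DFunLike.congr_fun h f
  rw [Derivation.commutator_apply] at this
  exact sub_eq_zero.mp this

/-- The scalar `[2r][r]/r` of the commutation relations. -/
def heisScalar (r : ℕ+) : QField := qInt (2 * r) * qInt r / (r : QField)

theorem heisPos_mul_heisNeg (r s : ℕ+) : heisPos r * heisNeg s =
    heisNeg s * heisPos r + if r = s then heisScalar r • (1 : Module.End QField Heis) else 0 := by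
  refine LinearMap.ext fun f => ?_
  rw [LinearMap.add_apply]
  simp only [Module.End.mul_apply, heisPos, heisNeg, LinearMap.smul_apply,
    LinearMap.mulLeft_apply, Derivation.coeFn_coe, Derivation.leibniz, MvPolynomial.pderiv_X,
    heisScalar]
  split_ifs with h
  · subst h
    simp [smul_add]
  · simp [Ne.symm h]

theorem coeff_zero_opSeries (c : ℕ+ → QField) (A : ℕ+ → Heis →ₗ[QField] Heis) :
    PowerSeries.coeff 0 (opSeries c A) = 0 := by
  simp [opSeries]

theorem coeff_opSeries (c : ℕ+ → QField) (A : ℕ+ → Heis →ₗ[QField] Heis) (r : ℕ+) :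
    PowerSeries.coeff (r : ℕ) (opSeries c A) = c r • A r := by
  rw [opSeries, PowerSeries.coeff_mk, dif_pos r.pos]
  rfl

theorem eq_zero_or_eq_pnat (n : ℕ) : n = 0 ∨ ∃ r : ℕ+, n = r := by
  by_cases h : 0 < n
  · exact Or.inr ⟨⟨n, h⟩, rfl⟩
  · exact Or.inl (by omega)

theorem commute_coeff_opSeries {A B : ℕ+ → Heis →ₗ[QField] Heis}
    (hAB : ∀ r s, Commute (A r) (B s)) (c d : ℕ+ → QField) (i j : ℕ) :
    Commute (PowerSeries.coeff i (opSeries c A)) (PowerSeries.coeff j (opSeries d B)) := by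
  obtain rfl | ⟨r, rfl⟩ := eq_zero_or_eq_pnat i
  · rw [coeff_zero_opSeries]; exact Commute.zero_left _
  obtain rfl | ⟨s, rfl⟩ := eq_zero_or_eq_pnat j
  · rw [coeff_zero_opSeries]; exact Commute.zero_right _
  · rw [coeff_opSeries, coeff_opSeries]
    exact ((hAB _ _).smul_left _).smul_right _

theorem exponentiable_opSeries {A : ℕ+ → Heis →ₗ[QField] Heis}
    (hA : ∀ r s, Commute (A r) (A s)) (c : ℕ+ → QField) : Exponentiable (opSeries c A) :=
  ⟨coeff_zero_opSeries c A, commute_coeff_opSeries hA c c⟩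

theorem expSeries_opSeries_add {A : ℕ+ → Heis →ₗ[QField] Heis}
    (hA : ∀ r s, Commute (A r) (A s)) (c d : ℕ+ → QField) :
    expSeries (opSeries (c + d) A) = expSeries (opSeries c A) * expSeries (opSeries d A) := by
  rw [← (exponentiable_opSeries hA c).expSeries_add (exponentiable_opSeries hA d)
    (commute_coeff_opSeries hA c d)]
  congr 1
  ext1 n
  rw [map_add]
  obtain rfl | ⟨r, rfl⟩ := eq_zero_or_eq_pnat n
  · simp only [coeff_zero_opSeries, add_zero]
  · simp only [coeff_opSeries, Pi.add_apply, add_smul]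

theorem coeff_expSeries_opSeries_rescale {A : ℕ+ → Heis →ₗ[QField] Heis}
    (hA : ∀ r s, Commute (A r) (A s)) (c : ℕ+ → QField) (b : QField) (n : ℕ) :
    PowerSeries.coeff n (expSeries (opSeries (fun r => b ^ (r : ℕ) * c r) A)) =
      b ^ n • PowerSeries.coeff n (expSeries (opSeries c A)) := by
  refine (exponentiable_opSeries hA c).coeff_expSeries_rescale b (fun n => ?_) n
  obtain rfl | ⟨r, rfl⟩ := eq_zero_or_eq_pnat n
  · simp only [coeff_zero_opSeries, smul_zero]
  · simp only [coeff_opSeries, mul_smul]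

/-- `[a(r), exp (∑ c_s a(-s) w ^ s)] = [2r][r]/r c_r w ^ r exp (∑ c_s a(-s) w ^ s)`. -/
theorem C_heisPos_mul_expSeries (c : ℕ+ → QField) (r : ℕ+) :
    PowerSeries.C (heisPos r) * expSeries (opSeries c heisNeg) =
      expSeries (opSeries c heisNeg) * PowerSeries.C (heisPos r) +
        (heisScalar r * c r) • (PowerSeries.X ^ (r : ℕ) * expSeries (opSeries c heisNeg)) := by
  set E := expSeries (opSeries c heisNeg) with hE
  set F := opSeries c heisNeg with hF
  have hEE : euler E = euler F * E :=
    (exponentiable_opSeries commute_heisNeg c).euler_expSeries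
  have hCF : PowerSeries.C (heisPos r) * euler F = euler F * PowerSeries.C (heisPos r) +
      (heisScalar r * c r) • euler (PowerSeries.X ^ (r : ℕ)) := by
    ext1 n
    rw [map_add, PowerSeries.coeff_C_mul, PowerSeries.coeff_mul_C, PowerSeries.coeff_smul,
      coeff_euler, coeff_euler, PowerSeries.coeff_X_pow, hF]
    obtain rfl | ⟨s, rfl⟩ := eq_zero_or_eq_pnat n
    · simp
    · rw [coeff_opSeries, mul_smul_comm, mul_smul_comm, heisPos_mul_heisNeg r s, smul_mul_assoc,
        smul_mul_assoc, smul_add, smul_add]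
      congr 1
      by_cases hrs : r = s
      · subst hrs
        rw [if_pos rfl, if_pos rfl, smul_comm _ (r : ℕ), smul_smul, mul_comm]
      · have : (s : ℕ) ≠ r := fun h => hrs (PNat.eq h.symm)
        simp [hrs, this]
  have hX : ∀ f : PowerSeries (Module.End QField Heis),
      f * PowerSeries.X ^ (r : ℕ) = PowerSeries.X ^ (r : ℕ) * f := fun f =>
    (PowerSeries.commute_X_pow f r).eq
  have hZ : PowerSeries.C (heisPos r) * E - (E * PowerSeries.C (heisPos r) +
        (heisScalar r * c r) • (PowerSeries.X ^ (r : ℕ) * E)) = 0 := by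
    refine eq_of_euler_eq (G := euler F) (by simp) ?_ ?_ ?_
    · rw [map_sub, map_add, PowerSeries.coeff_C_mul, PowerSeries.coeff_mul_C,
        PowerSeries.coeff_smul, PowerSeries.coeff_X_pow_mul', if_neg (by have := r.pos; omega)]
      simp [hE, coeff_zero_expSeries]
    · have hsm : ∀ (x : QField) (f : PowerSeries (Module.End QField Heis)),
          euler (x • f) = x • euler f := fun x f => by
        ext1 n; simp
      rw [euler_sub, euler_add, euler_mul, euler_mul, hsm, euler_mul, euler_C, zero_mul, zero_add,
        mul_zero, add_zero, hEE, ← mul_assoc, hCF, mul_sub, mul_add, add_mul, mul_smul_comm,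
        smul_add, ← mul_assoc (PowerSeries.X ^ (r : ℕ)), ← hX (euler F)]
      simp only [mul_assoc, smul_mul_assoc]
      abel
    · rw [mul_zero]; ext n; simp
  exact sub_eq_zero.mp hZ

/-- The power series `∑_{r ≥ 1} c_r w ^ r`. -/
def scalarSeries (c : ℕ+ → QField) : PowerSeries QField :=
  PowerSeries.mk fun n => if h : 0 < n then c ⟨n, h⟩ else 0

theorem coeff_zero_scalarSeries (c : ℕ+ → QField) : PowerSeries.coeff 0 (scalarSeries c) = 0 := by
  simp [scalarSeries]

theorem coeff_scalarSeries (c : ℕ+ → QField) (r : ℕ+) :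
    PowerSeries.coeff (r : ℕ) (scalarSeries c) = c r := by
  rw [scalarSeries, PowerSeries.coeff_mk, dif_pos r.pos]
  rfl

/-- The contraction of `exp (∑ d_r a(r) u ^ r)` and `exp (∑ c_r a(-r) w ^ r)` is
`exp (∑ [2r][r]/r d_r c_r (u w) ^ r)`; here the polynomial `P` is this exponential, which is
expressed by its logarithmic derivative. -/
def IsContraction (d c : ℕ+ → QField) (P : Polynomial QField) : Prop :=
  P.coeff 0 = 1 ∧ euler (P : PowerSeries QField) =
    scalarSeries (fun r => (r : QField) * (heisScalar r * d r * c r)) * (P : PowerSeries QField)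

instance : IsAddTorsionFree (PowerSeries (Module.End QField Heis)) :=
  IsAddTorsionFree.of_module_rat _

/-- The commutation relation between annihilation and creation exponentials, in the ring of power
series in `u` over power series in `w` over the operators. Both sides solve the same differential
equation in `u`. -/
theorem map_C_expSeries_mul {d c : ℕ+ → QField} {P : Polynomial QField}
    (hP : IsContraction d c P) :
    PowerSeries.map PowerSeries.C (expSeries (opSeries d heisPos)) *
        PowerSeries.C (expSeries (opSeries c heisNeg)) =
      PowerSeries.mk
          (fun l => P.coeff l • (PowerSeries.X : PowerSeries (Module.End QField Heis)) ^ l) *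
        (PowerSeries.C (expSeries (opSeries c heisNeg)) *
          PowerSeries.map PowerSeries.C (expSeries (opSeries d heisPos))) := by
  set E := expSeries (opSeries c heisNeg) with hE
  set Q := PowerSeries.mk
    (fun l => P.coeff l • (PowerSeries.X : PowerSeries (Module.End QField Heis)) ^ l) with hQ
  set T := expSeries (opSeries d heisPos) with hT
  set F := opSeries d heisPos with hF
  have hET : euler T = euler F * T :=
    (exponentiable_opSeries commute_heisPos d).euler_expSeries
  have hmap : ∀ f : PowerSeries (Module.End QField Heis),
      euler (PowerSeries.map PowerSeries.C f) = PowerSeries.map PowerSeries.C (euler f) := by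
    intro f; ext1 n; simp
  set G := scalarSeries (fun r => (r : QField) * (heisScalar r * d r * c r)) with hG
  set R := PowerSeries.mk (fun n => PowerSeries.coeff n G •
        (PowerSeries.X : PowerSeries (Module.End QField Heis)) ^ n) with hR
  have hFE : PowerSeries.map PowerSeries.C (euler F) * PowerSeries.C E =
      PowerSeries.C E * PowerSeries.map PowerSeries.C (euler F) + R * PowerSeries.C E := by
    ext1 n
    rw [map_add, PowerSeries.coeff_C_mul, PowerSeries.coeff_mul_C, PowerSeries.coeff_mul_C,
      PowerSeries.coeff_map, hR, PowerSeries.coeff_mk, coeff_euler, hF]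
    obtain rfl | ⟨r, rfl⟩ := eq_zero_or_eq_pnat n
    · simp [hG, coeff_zero_scalarSeries]
    · rw [hG, coeff_scalarSeries, coeff_opSeries, ← Nat.cast_smul_eq_nsmul QField, smul_smul]
      have hC : ∀ x : QField, PowerSeries.C (x • heisPos r) = x • PowerSeries.C (heisPos r) := by
        intro x
        ext1 m
        simp only [PowerSeries.coeff_C, PowerSeries.coeff_smul]
        split_ifs <;> simp
      rw [hC, smul_mul_assoc, C_heisPos_mul_expSeries c r, smul_add, mul_smul_comm, smul_smul,
        smul_mul_assoc]
      congr 2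
      ring
  have hQR : euler Q = R * Q := by
    ext1 n
    have h := congrArg (PowerSeries.coeff n) hP.2
    rw [coeff_euler, PowerSeries.coeff_mul, Polynomial.coeff_coe] at h
    rw [coeff_euler, hQ, PowerSeries.coeff_mk, ← smul_assoc, h, PowerSeries.coeff_mul,
      Finset.sum_smul]
    refine Finset.sum_congr rfl fun x hx => ?_
    rw [← hG, hR, PowerSeries.coeff_mk, PowerSeries.coeff_mk, Polynomial.coeff_coe,
      smul_mul_smul_comm, ← pow_add, Finset.HasAntidiagonal.mem_antidiagonal.mp hx]
  have hcQ : Commute (PowerSeries.map PowerSeries.C (euler F)) Q := commute_of_coeff fun i j => by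
    rw [hQ, PowerSeries.coeff_mk]
    exact (PowerSeries.commute_X_pow _ _).smul_right _
  have hRQ : Commute R Q := commute_of_coeff fun i j => by
    rw [hQ, PowerSeries.coeff_mk]
    exact (PowerSeries.commute_X_pow _ _).smul_right _
  refine eq_of_euler_eq (G := PowerSeries.map PowerSeries.C (euler F)) ?_ ?_ ?_ ?_
  · simp
  · simp [PowerSeries.coeff_mul, hQ, hP.1, hT, coeff_zero_expSeries]
  · rw [euler_mul, euler_C, mul_zero, add_zero, hmap, hET, map_mul, mul_assoc]
  · rw [euler_mul, euler_mul, euler_C, zero_mul, zero_add, hmap, hET, map_mul, hQR, hRQ.eq,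
      ← mul_assoc _ Q, hcQ.eq, mul_assoc Q (PowerSeries.map PowerSeries.C (euler F)),
      ← mul_assoc (PowerSeries.map PowerSeries.C (euler F)) (PowerSeries.C E), hFE, add_mul,
      mul_add]
    simp only [mul_assoc]
    abel

/-! ### Products of normally ordered exponentials -/

theorem expNeg_of_neg (c : ℕ+ → QField) {n : ℤ} (h : n < 0) : expNeg c n = 0 := by
  rw [expNeg, if_neg (not_le.mpr h)]

theorem expNeg_natCast (c : ℕ+ → QField) (n : ℕ) :
    expNeg c n = PowerSeries.coeff n (expSeries (opSeries c heisNeg)) := by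
  rw [expNeg, if_pos (Int.natCast_nonneg n), Int.toNat_natCast]

theorem expNeg_comm (c d : ℕ+ → QField) (m n : ℤ) (f : Heis) :
    expNeg c m (expNeg d n f) = expNeg d n (expNeg c m f) := by
  rcases lt_or_ge m 0 with hm | hm
  · simp [expNeg_of_neg c hm]
  rcases lt_or_ge n 0 with hn | hn
  · simp [expNeg_of_neg d hn]
  lift m to ℕ using hm
  lift n to ℕ using hn
  rw [expNeg_natCast, expNeg_natCast]
  have : Commute (PowerSeries.coeff m (expSeries (opSeries c heisNeg)))
      (PowerSeries.coeff n (expSeries (opSeries d heisNeg))) :=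
    commute_coeff_expSeries (fun j => (commute_coeff_expSeries (fun i =>
      commute_coeff_opSeries commute_heisNeg d c j i) m).symm) n
  exact LinearMap.congr_fun this.eq f

theorem expNeg_rescale (c : ℕ+ → QField) (b : QField) (n : ℤ) :
    expNeg (fun r => b ^ (r : ℕ) * c r) n = b ^ n • expNeg c n := by
  rcases lt_or_ge n 0 with hn | hn
  · simp [expNeg_of_neg _ hn]
  · lift n to ℕ using hn
    rw [expNeg_natCast, expNeg_natCast, coeff_expSeries_opSeries_rescale commute_heisNeg,
      zpow_natCast]

theorem expPos_rescale (d : ℕ+ → QField) (b : QField) (n : ℕ) :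
    expPos (fun r => b ^ (r : ℕ) * d r) n = b ^ n • expPos d n :=
  coeff_expSeries_opSeries_rescale commute_heisPos d b n

theorem expNeg_add (c d : ℕ+ → QField) (n : ℤ) (f : Heis) :
    ∑ᶠ a : ℤ, expNeg c a (expNeg d (n - a) f) = expNeg (c + d) n f := by
  have hz : ∀ a : ℤ, ¬ (0 ≤ a ∧ a ≤ n) → expNeg c a (expNeg d (n - a) f) = 0 := by
    intro a ha
    by_cases h : 0 ≤ a
    · rw [expNeg_of_neg d (by omega), LinearMap.zero_apply, map_zero]
    · rw [expNeg_of_neg c (by omega), LinearMap.zero_apply]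
  rcases lt_or_ge n 0 with hn | hn
  · rw [expNeg_of_neg _ hn]
    exact finsum_eq_zero_of_forall_eq_zero fun a => hz a (by omega)
  · lift n to ℕ using hn
    rw [finsum_eq_sum_of_support_subset (s := (Finset.range (n + 1)).map Nat.castEmbedding)]
    · rw [Finset.sum_map, expNeg_natCast, expSeries_opSeries_add commute_heisNeg,
        PowerSeries.coeff_mul, Finset.Nat.sum_antidiagonal_eq_sum_range_succ_mk,
        LinearMap.sum_apply]
      refine Finset.sum_congr rfl fun k hk => ?_
      have hk' : k ≤ n := by simpa [Nat.lt_succ_iff] using hk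
      rw [Nat.castEmbedding_apply, ← Nat.cast_sub hk', expNeg_natCast, expNeg_natCast]
      rfl
    · intro a ha
      have h := not_imp_comm.mp (hz a) ha
      simp only [Finset.coe_map, Set.mem_image, Finset.mem_coe, Finset.mem_range]
      exact ⟨a.toNat, by omega, by simp [h.1]⟩

theorem expPos_add (c d : ℕ+ → QField) (n : ℕ) (f : Heis) :
    expPos (c + d) n f =
      ∑ x ∈ Finset.HasAntidiagonal.antidiagonal n, expPos c x.1 (expPos d x.2 f) := by
  rw [expPos, expSeries_opSeries_add commute_heisPos, PowerSeries.coeff_mul, LinearMap.sum_apply]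
  rfl

/-- The commutation relation `map_C_expSeries_mul` on coefficients. -/
theorem expPos_expNeg {d c : ℕ+ → QField} {P : Polynomial QField} (hP : IsContraction d c P)
    (j : ℕ) (i : ℤ) (f : Heis) :
    expPos d j (expNeg c i f) =
      ∑ x ∈ Finset.HasAntidiagonal.antidiagonal j,
        P.coeff x.1 • expNeg c (i - x.1) (expPos d x.2 f) := by
  rcases lt_or_ge i 0 with hi | hi
  · rw [expNeg_of_neg c hi, LinearMap.zero_apply, map_zero]
    refine (Finset.sum_eq_zero fun x _ => ?_).symm
    rw [expNeg_of_neg c (by omega), LinearMap.zero_apply, smul_zero]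
  · lift i to ℕ using hi
    have h := congrArg (fun s => PowerSeries.coeff i (PowerSeries.coeff j s))
      (map_C_expSeries_mul hP)
    simp only [PowerSeries.coeff_mul_C, PowerSeries.coeff_map, PowerSeries.coeff_C_mul] at h
    rw [PowerSeries.coeff_mul, map_sum] at h
    have h' := LinearMap.congr_fun h f
    rw [LinearMap.sum_apply] at h'
    rw [expNeg_natCast]
    refine h'.trans (Finset.sum_congr rfl fun x _ => ?_)
    rw [PowerSeries.coeff_mk, PowerSeries.coeff_C_mul, PowerSeries.coeff_map, smul_mul_assoc,
      PowerSeries.coeff_smul, ← mul_assoc, PowerSeries.coeff_mul_C, PowerSeries.coeff_X_pow_mul',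
      LinearMap.smul_apply]
    split_ifs with hx
    · rw [← Nat.cast_sub hx, expNeg_natCast]
      rfl
    · rw [expNeg_of_neg c (by omega)]
      simp

theorem expMode_apply (c d : ℕ+ → QField) (n : ℤ) {f : Heis} {J : ℕ}
    (hJ : ∀ j ≥ J, expPos d j f = 0) :
    expMode c d n f = ∑ j ∈ Finset.range J, expNeg c (n + j) (expPos d j f) := by
  change ∑ᶠ j : ℕ, expNeg c (n + j) (expPos d j f) = _
  refine finsum_eq_sum_of_support_subset _ fun j hj => ?_
  rw [Finset.mem_coe, Finset.mem_range]
  by_contra hc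
  exact hj (by simp only [hJ j (not_lt.mp hc), map_zero])

theorem expMode_rescale (c d : ℕ+ → QField) {b : QField} (hb : b ≠ 0) (n : ℤ) :
    expMode (fun r => b ^ (r : ℕ) * c r) (fun r => b⁻¹ ^ (r : ℕ) * d r) n =
      b ^ n • expMode c d n := by
  refine LinearMap.ext fun f => ?_
  obtain ⟨J, hJ⟩ := exists_expPos_eq_zero d f
  rw [LinearMap.smul_apply, expMode_apply c d n hJ, expMode_apply _ _ n (J := J),
    Finset.smul_sum]
  · refine Finset.sum_congr rfl fun j _ => ?_
    rw [expNeg_rescale, expPos_rescale, LinearMap.smul_apply, LinearMap.smul_apply, map_smul,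
      smul_smul, zpow_add₀ hb, zpow_natCast, inv_pow, mul_assoc,
      mul_inv_cancel₀ (pow_ne_zero _ hb), mul_one]
  · intro j hj
    rw [expPos_rescale, LinearMap.smul_apply, hJ j hj, smul_zero]

/-- The sum of a function on `ℕ × ℕ` with support in a rectangle, by diagonals and by rows. -/
theorem sum_antidiagonal_eq_sum_product {M : Type*} [AddCommMonoid M] (F : ℕ × ℕ → M) {L J K : ℕ}
    (hF : ∀ x : ℕ × ℕ, ¬ (x.1 < L ∧ x.2 < J) → F x = 0)
    (hK : ∀ x : ℕ × ℕ, x.1 < L → x.2 < J → F x ≠ 0 → x.1 + x.2 < K) :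
    ∑ j ∈ Finset.range K, ∑ x ∈ Finset.HasAntidiagonal.antidiagonal j, F x =
      ∑ l ∈ Finset.range L, ∑ b ∈ Finset.range J, F (l, b) := by
  classical
  rw [← Finset.sum_product', Finset.sum_sigma']
  refine Finset.sum_bij_ne_zero (fun y _ _ => y.2) ?_ ?_ ?_ ?_
  · rintro ⟨j, x⟩ _ h
    rw [Finset.mem_product, Finset.mem_range, Finset.mem_range]
    exact not_imp_comm.mp (hF x) h
  · rintro ⟨j, x⟩ h _ ⟨j', x'⟩ h' _ rfl
    simp only [Finset.mem_sigma, Finset.mem_range, Finset.HasAntidiagonal.mem_antidiagonal] at h h'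
    obtain ⟨-, rfl⟩ := h
    obtain ⟨-, rfl⟩ := h'
    rfl
  · intro x hx h
    rw [Finset.mem_product, Finset.mem_range, Finset.mem_range] at hx
    exact ⟨⟨x.1 + x.2, x⟩, by simpa using hK x hx.1 hx.2 h, h, rfl⟩
  · intros
    rfl

/-- Moving a creation exponential to the left through a normally ordered exponential produces the
contraction. -/
theorem expMode_expNeg {c d c' : ℕ+ → QField} {P : Polynomial QField} (hP : IsContraction d c' P)
    (n i : ℤ) (g : Heis) :
    expMode c d n (expNeg c' i g) =
      ∑ l ∈ Finset.range (P.natDegree + 1),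
        P.coeff l • expNeg c' (i - l) (expMode c d (n + l) g) := by
  obtain ⟨J, hJ⟩ := exists_expPos_eq_zero d g
  have hP0 : ∀ l, ¬ l < P.natDegree + 1 → P.coeff l = 0 := fun l hl =>
    Polynomial.coeff_eq_zero_of_natDegree_lt (by omega)
  rw [expMode_apply c d n (J := P.natDegree + 1 + J)]
  · simp_rw [expPos_expNeg hP]
    have h : ∀ j : ℕ, expNeg c (n + j) (∑ x ∈ Finset.HasAntidiagonal.antidiagonal j,
        P.coeff x.1 • expNeg c' (i - x.1) (expPos d x.2 g)) =
        ∑ x ∈ Finset.HasAntidiagonal.antidiagonal j,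
          P.coeff x.1 • expNeg c' (i - x.1) (expNeg c (n + x.1 + x.2) (expPos d x.2 g)) := by
      intro j
      rw [map_sum]
      refine Finset.sum_congr rfl fun x hx => ?_
      rw [map_smul, expNeg_comm, ← Finset.HasAntidiagonal.mem_antidiagonal.mp hx, Nat.cast_add,
        add_assoc]
    simp_rw [h]
    rw [sum_antidiagonal_eq_sum_product (fun x : ℕ × ℕ =>
      P.coeff x.1 • expNeg c' (i - x.1) (expNeg c (n + x.1 + x.2) (expPos d x.2 g)))
      (L := P.natDegree + 1) (J := J)]
    · refine Finset.sum_congr rfl fun l _ => ?_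
      rw [expMode_apply c d _ hJ, map_sum, Finset.smul_sum]
    · intro x hx
      by_cases h1 : x.1 < P.natDegree + 1
      · simp [hJ x.2 (by omega)]
      · simp [hP0 _ h1]
    · intro x h1 h2 _
      omega
  · intro j hj
    rw [expPos_expNeg hP]
    refine Finset.sum_eq_zero fun x hx => ?_
    have hx' := Finset.HasAntidiagonal.mem_antidiagonal.mp hx
    by_cases h1 : x.1 < P.natDegree + 1
    · simp [hJ x.2 (by omega)]
    · simp [hP0 _ h1]

theorem expMode_expMode {c d c' d' : ℕ+ → QField} {P : Polynomial QField}
    (hP : IsContraction d c' P) (n n' : ℤ) {f : Heis} {J : ℕ}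
    (hJ : ∀ j ≥ J, expPos d' j f = 0) :
    expMode c d n (expMode c' d' n' f) = ∑ j ∈ Finset.range J,
      ∑ l ∈ Finset.range (P.natDegree + 1), P.coeff l •
        expNeg c' (n' + j - l) (expMode c d (n + l) (expPos d' j f)) := by
  rw [expMode_apply c' d' n' hJ, map_sum]
  simp_rw [expMode_expNeg hP]

/-- As the contraction is a polynomial, the exponents of both variables are bounded from below. -/
theorem exists_expMode_expMode_eq_zero {c d c' d' : ℕ+ → QField} {P : Polynomial QField}
    (hP : IsContraction d c' P) (f : Heis) :
    ∃ N : ℤ, ∀ n n' : ℤ, (n < N ∨ n' < N) → expMode c d n (expMode c' d' n' f) = 0 := by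
  obtain ⟨J, hJ⟩ := exists_expPos_eq_zero d' f
  choose B hB using fun j => exists_expMode_eq_zero c d (expPos d' j f)
  obtain ⟨M, hM⟩ := ((Finset.range J).image B).bddBelow
  refine ⟨min (M - P.natDegree) (-J), fun n n' h => ?_⟩
  rw [expMode_expMode hP n n' hJ]
  refine Finset.sum_eq_zero fun j hj => Finset.sum_eq_zero fun l hl => ?_
  have hMj := hM (Finset.mem_coe.mpr (Finset.mem_image_of_mem B hj))
  rw [Finset.mem_range] at hj hl
  rcases h with h | h
  · rw [hB j _ (by omega), map_zero, smul_zero]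
  · rw [expNeg_of_neg c' (by omega), LinearMap.zero_apply, smul_zero]

theorem finite_support_expNeg_expMode (c d c' : ℕ+ → QField) (M : ℤ) (g : Heis) :
    (Function.support fun n : ℤ => expNeg c' (M - n) (expMode c d n g)).Finite := by
  obtain ⟨N, hN⟩ := exists_expMode_eq_zero c d g
  refine (Set.finite_Icc N M).subset fun n hn => ?_
  by_contra hc
  rw [Set.mem_Icc, not_and_or, not_le, not_le] at hc
  refine hn ?_
  rcases hc with h | h
  · simp only [hN n h, map_zero]
  · simp only [expNeg_of_neg c' (show M - n < 0 by omega), LinearMap.zero_apply]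

theorem finsum_expNeg_expMode (c d c' : ℕ+ → QField) (M : ℤ) (g : Heis) :
    ∑ᶠ n : ℤ, expNeg c' (M - n) (expMode c d n g) = expMode (c + c') d M g := by
  obtain ⟨J, hJ⟩ := exists_expPos_eq_zero d g
  rw [expMode_apply _ _ _ hJ]
  simp_rw [expMode_apply c d _ hJ, map_sum]
  rw [finsum_sum_comm]
  · refine Finset.sum_congr rfl fun j _ => ?_
    rw [← expNeg_add]
    refine (finsum_congr fun n => ?_).trans (finsum_comp_equiv (Equiv.addRight (j : ℤ)))
    rw [expNeg_comm, Equiv.coe_addRight, add_sub_add_right_eq_sub]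
  · intro j _
    refine (Set.finite_Icc (-j : ℤ) M).subset fun n hn => ?_
    by_contra hc
    rw [Set.mem_Icc, not_and_or, not_le, not_le] at hc
    refine hn ?_
    rcases hc with h | h
    · simp only [expNeg_of_neg c (show n + j < 0 by omega), LinearMap.zero_apply, map_zero]
    · simp only [expNeg_of_neg c' (show M - n < 0 by omega), LinearMap.zero_apply]

/-- Setting both variables equal turns the product of two normally ordered exponentials into one,
multiplied by the value of the contraction at `1`. -/
theorem finsum_expMode_expMode {c d c' d' : ℕ+ → QField} {P : Polynomial QField}
    (hP : IsContraction d c' P) (M : ℤ) (f : Heis) :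
    ∑ᶠ n : ℤ, expMode c d n (expMode c' d' (M - n) f) =
      P.eval 1 • expMode (c + c') (d + d') M f := by
  -- `J` exceeds the weight of `f`, so it truncates all sums over annihilation exponentials,
  -- including the double ones.
  obtain ⟨D, hD⟩ := exists_mem_weightLE f
  obtain ⟨J, hJ⟩ : ∃ J : ℕ, D < J := ⟨D.toNat + 1, by omega⟩
  have hmem : ∀ (e : ℕ+ → QField) (j : ℕ) {d : ℤ} {g : Heis}, g ∈ weightLE d →
      expPos e j g ∈ weightLE (d - j) := by
    intro e j d g hg
    rw [expPos, expSeries, PowerSeries.coeff_mk, LinearMap.sum_apply]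
    exact Submodule.sum_mem _ fun k _ =>
      Submodule.smul_mem _ _ (coeff_pow_opSeries_mem e k j hg)
  have h1 : ∀ (e : ℕ+ → QField), ∀ j ≥ J, expPos e j f = 0 := fun e j hj =>
    weightLE_neg (by omega) (hmem e j hD)
  have h2 : ∀ i j : ℕ, J ≤ i + j → expPos d i (expPos d' j f) = 0 := fun i j hij =>
    weightLE_neg (by omega) (hmem d i (hmem d' j hD))
  have hshift : ∀ (j l : ℕ) (n : ℤ),
      expNeg c' (M - n + j - l) (expMode c d (n + l) (expPos d' j f)) =
        expNeg c' (M + j - (n + l)) (expMode c d (n + l) (expPos d' j f)) := by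
    intro j l n
    congr 2
    ring
  have hfin : ∀ j l : ℕ, (Function.support fun n : ℤ => P.coeff l •
      expNeg c' (M + j - (n + l)) (expMode c d (n + l) (expPos d' j f))).Finite := by
    intro j l
    refine (((finite_support_expNeg_expMode c d c' (M + j) (expPos d' j f)).preimage
      (Equiv.addRight (l : ℤ)).injective.injOn)).subset fun n hn => ?_
    simp only [Set.mem_preimage, Function.mem_support, Equiv.coe_addRight] at hn ⊢
    exact fun h => hn (by rw [h, smul_zero])
  have hl : ∀ j l : ℕ, ∑ᶠ n : ℤ, P.coeff l •
      expNeg c' (M + j - (n + l)) (expMode c d (n + l) (expPos d' j f)) =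
        P.coeff l • expMode (c + c') d (M + j) (expPos d' j f) := by
    intro j l
    rw [← smul_finsum, ← finsum_expNeg_expMode c d c' (M + j)]
    congr 1
    exact finsum_comp_equiv (Equiv.addRight (l : ℤ))
      (f := fun n => expNeg c' (M + j - n) (expMode c d n (expPos d' j f)))
  simp_rw [expMode_expMode hP _ _ (h1 d'), hshift]
  rw [finsum_sum_comm]
  swap
  · intro j _
    refine (Set.Finite.subset (Set.Finite.biUnion (Finset.finite_toSet _) fun l _ => hfin j l)
      (Finset.support_sum (s := Finset.range (P.natDegree + 1)) _))
  rw [Polynomial.eval_eq_sum_range]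
  simp only [one_pow, mul_one]
  have hj : ∀ j : ℕ, (∑ᶠ n : ℤ, ∑ l ∈ Finset.range (P.natDegree + 1), P.coeff l •
      expNeg c' (M + j - (n + l)) (expMode c d (n + l) (expPos d' j f))) =
        (∑ l ∈ Finset.range (P.natDegree + 1), P.coeff l) •
          expMode (c + c') d (M + j) (expPos d' j f) := by
    intro j
    rw [finsum_sum_comm _ _ fun l _ => hfin j l, Finset.sum_smul]
    exact Finset.sum_congr rfl fun l _ => hl j l
  simp_rw [hj]
  rw [← Finset.smul_sum]
  congr 1
  rw [expMode_apply _ _ _ (h1 (d + d'))]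
  have h3 : ∀ j : ℕ, ∀ i ≥ J, expPos d i (expPos d' j f) = 0 := fun j i hi => h2 i j (by omega)
  simp_rw [expMode_apply _ _ _ (h3 _), expPos_add, map_sum]
  rw [Finset.sum_comm, ← sum_antidiagonal_eq_sum_product (fun x : ℕ × ℕ =>
    expNeg (c + c') (M + x.2 + x.1) (expPos d x.1 (expPos d' x.2 f))) (L := J) (J := J) (K := J)]
  · refine Finset.sum_congr rfl fun j _ => Finset.sum_congr rfl fun x hx => ?_
    rw [← Finset.HasAntidiagonal.mem_antidiagonal.mp hx, Nat.cast_add]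
    congr 2
    ring
  · intro x hx
    simp only [h2 x.1 x.2 (by omega), map_zero]
  · intro x _ _ hx
    by_contra hc
    exact hx (by simp only [h2 x.1 x.2 (by omega), map_zero])

/-! ### Products of quasi-commutative pairs -/

section Pairs

variable {F : Type*} [Field F] {K L : Type*} [AddCommGroup K] [Module F K]
  [AddCommGroup L] [Module F L]

theorem ext_mode {a b : LaurentHom F K L} (h : ∀ n v, mode a n v = mode b n v) : a = b := by
  ext v n
  exact h n v

theorem mode_zero_apply (n : ℤ) (v : K) : mode (0 : LaurentHom F K L) n v = 0 := rfl

theorem mode_add_apply (a b : LaurentHom F K L) (n : ℤ) (v : K) :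
    mode (a + b) n v = mode a n v + mode b n v := rfl

theorem mode_smul_apply (r : F) (a : LaurentHom F K L) (n : ℤ) (v : K) :
    mode (r • a) n v = r • mode a n v := rfl

theorem quasiCommutative_singleton_iff {a : LaurentHom F L L} {b : LaurentHom F K L} :
    QuasiCommutative [a] b ↔
      ∀ v, ∃ N : ℤ, ∀ i n : ℤ, (n < N ∨ i < N) → mode a i (mode b n v) = 0 := by
  refine ⟨fun h => h.pair, fun h v => ?_⟩
  obtain ⟨N, hN⟩ := h v
  refine ⟨N, fun e he n hn => ?_⟩
  obtain ⟨i, rfl⟩ := List.length_eq_one_iff.mp he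
  simpa [modeWord] using hN i n (by simpa using hn)

theorem QuasiCommutative.add_left {a a' : LaurentHom F L L} {b : LaurentHom F K L}
    (h : QuasiCommutative [a] b) (h' : QuasiCommutative [a'] b) :
    QuasiCommutative [a + a'] b := by
  rw [quasiCommutative_singleton_iff] at *
  intro v
  obtain ⟨N, hN⟩ := h v
  obtain ⟨N', hN'⟩ := h' v
  refine ⟨min N N', fun i n hin => ?_⟩
  rw [mode_add_apply, hN i n (by omega), hN' i n (by omega), add_zero]

theorem QuasiCommutative.smul_left {a : LaurentHom F L L} {b : LaurentHom F K L}
    (h : QuasiCommutative [a] b) (r : F) : QuasiCommutative [r • a] b := by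
  rw [quasiCommutative_singleton_iff] at *
  intro v
  obtain ⟨N, hN⟩ := h v
  refine ⟨N, fun i n hin => ?_⟩
  rw [mode_smul_apply, hN i n hin, smul_zero]

theorem QuasiCommutative.sub_left {a a' : LaurentHom F L L} {b : LaurentHom F K L}
    (h : QuasiCommutative [a] b) (h' : QuasiCommutative [a'] b) :
    QuasiCommutative [a - a'] b := by
  rw [sub_eq_add_neg, ← neg_one_smul F a']
  exact h.add_left (h'.smul_left _)

/-- The `b(z)` for which `(a(z), b(z))` is quasi-commutative. -/
def quasiCommutant (a : LaurentHom F L L) : Submodule F (LaurentHom F K L) where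
  carrier := {b | QuasiCommutative [a] b}
  add_mem' {b b'} h h' := by
    rw [Set.mem_ofPred_eq, quasiCommutative_singleton_iff] at *
    intro v
    obtain ⟨N, hN⟩ := h v
    obtain ⟨N', hN'⟩ := h' v
    refine ⟨min N N', fun i n hin => ?_⟩
    rw [mode_add_apply, map_add, hN i n (by omega), hN' i n (by omega), add_zero]
  zero_mem' := by
    rw [Set.mem_ofPred_eq, quasiCommutative_singleton_iff]
    exact fun v => ⟨0, fun i n _ => by rw [mode_zero_apply, map_zero]⟩
  smul_mem' r b h := by
    rw [Set.mem_ofPred_eq, quasiCommutative_singleton_iff] at *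
    intro v
    obtain ⟨N, hN⟩ := h v
    exact ⟨N, fun i n hin => by rw [mode_smul_apply, map_smul, hN i n hin, smul_zero]⟩

theorem mem_quasiCommutant {a : LaurentHom F L L} {b : LaurentHom F K L} :
    b ∈ quasiCommutant a ↔ QuasiCommutative [a] b := Iff.rfl

theorem mode_mulField {a : LaurentHom F L L} {b : LaurentHom F K L} (h : QuasiCommutative [a] b)
    (n : ℤ) (v : K) :
    mode (mulField a b) n v = ∑ᶠ i : ℤ, mode a i (mode b (n - i) v) := by
  rw [mulField, dif_pos h, mode_ofModes]
  rfl

theorem QuasiCommutative.finite_support {a : LaurentHom F L L} {b : LaurentHom F K L}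
    (h : QuasiCommutative [a] b) (n : ℤ) (v : K) :
    (Function.support fun i : ℤ => mode a i (mode b (n - i) v)).Finite := by
  obtain ⟨N, hN⟩ := h.pair v
  refine (Set.finite_Icc N (n - N)).subset fun i hi => ?_
  by_contra hc
  rw [Set.mem_Icc, not_and_or, not_le, not_le] at hc
  exact hi (hN i (n - i) (by omega))

theorem mulField_add_left {a a' : LaurentHom F L L} {b : LaurentHom F K L}
    (h : QuasiCommutative [a] b) (h' : QuasiCommutative [a'] b) :
    mulField (a + a') b = mulField a b + mulField a' b := by
  refine ext_mode fun n v => ?_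
  rw [mode_add_apply, mode_mulField (h.add_left h'), mode_mulField h, mode_mulField h',
    ← finsum_add_distrib (h.finite_support n v) (h'.finite_support n v)]
  rfl

theorem mulField_smul_left {a : LaurentHom F L L} {b : LaurentHom F K L}
    (h : QuasiCommutative [a] b) (r : F) : mulField (r • a) b = r • mulField a b := by
  refine ext_mode fun n v => ?_
  rw [mode_smul_apply, mode_mulField (h.smul_left r), mode_mulField h, smul_finsum]
  rfl

theorem mulField_sub_left {a a' : LaurentHom F L L} {b : LaurentHom F K L}
    (h : QuasiCommutative [a] b) (h' : QuasiCommutative [a'] b) :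
    mulField (a - a') b = mulField a b - mulField a' b := by
  rw [eq_sub_iff_add_eq, ← mulField_add_left (h.sub_left h') h', sub_add_cancel]

theorem mulField_add_right {a : LaurentHom F L L} {b b' : LaurentHom F K L}
    (h : b ∈ quasiCommutant a) (h' : b' ∈ quasiCommutant a) :
    mulField a (b + b') = mulField a b + mulField a b' := by
  refine ext_mode fun n v => ?_
  rw [mode_add_apply, mode_mulField (add_mem h h' : _ ∈ quasiCommutant a), mode_mulField h,
    mode_mulField h', ← finsum_add_distrib (QuasiCommutative.finite_support h n v)
      (QuasiCommutative.finite_support h' n v)]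
  exact finsum_congr fun i => by rw [mode_add_apply, map_add]

theorem mulField_smul_right {a : LaurentHom F L L} {b : LaurentHom F K L}
    (h : b ∈ quasiCommutant a) (r : F) : mulField a (r • b) = r • mulField a b := by
  refine ext_mode fun n v => ?_
  rw [mode_smul_apply, mode_mulField ((quasiCommutant a).smul_mem r h), mode_mulField h,
    smul_finsum]
  exact finsum_congr fun i => by rw [mode_smul_apply, map_smul]

theorem mode_rescale (p : F) (k : ℕ) (a : LaurentHom F K L) (n : ℤ) (v : K) :
    mode (rescale p k a) n v = p ^ ((k : ℤ) * n) • mode a n v := by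
  rw [rescale, mode_ofModes]
  rfl

theorem rescale_add (p : F) (k : ℕ) (a b : LaurentHom F K L) :
    rescale p k (a + b) = rescale p k a + rescale p k b :=
  ext_mode fun n v => by simp only [mode_rescale, mode_add_apply, smul_add]

theorem rescale_smul (p : F) (k : ℕ) (r : F) (a : LaurentHom F K L) :
    rescale p k (r • a) = r • rescale p k a :=
  ext_mode fun n v => by simp only [mode_rescale, mode_smul_apply, smul_comm r]

theorem mode_qDeriv (p : F) (a : LaurentHom F K L) (n : ℤ) (v : K) :
    mode (qDeriv p a) n v = ((p - 1)⁻¹ * (p ^ (n + 1) - 1)) • mode a (n + 1) v := by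
  rw [qDeriv, mode_ofModes, mul_smul, sub_smul, one_smul]
  rfl

theorem prod_negSucc (p : F) (a : LaurentHom F L L) (n : ℕ) (b : LaurentHom F K L) :
    prod p a (Int.negSucc n) b = (qFact p n)⁻¹ • mulField ((qDeriv p)^[n] a) (rescale p n b) :=
  rfl

/-! ### The difference operator -/

/-- The `p`-difference operator `(D g)(a) = p ^ (-a) (g(a + 1) - g(a))` on sequences; up to the
factor `(z (p - 1))⁻¹` this is the `p`-derivation along the points `z p ^ a`. -/
def qDiff (p : F) (E : Type*) [AddCommGroup E] [Module F E] : Module.End F (ℕ → E) where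
  toFun g a := (p ^ a)⁻¹ • (g (a + 1) - g a)
  map_add' g g' := by
    funext a
    simp only [Pi.add_apply, ← smul_add]
    congr 1
    abel
  map_smul' r g := by
    funext a
    simp only [Pi.smul_apply, RingHom.id_apply, ← smul_sub, smul_comm r]

variable {E : Type*} [AddCommGroup E] [Module F E]

theorem qDiff_apply (p : F) (g : ℕ → E) (a : ℕ) :
    qDiff p E g a = (p ^ a)⁻¹ • (g (a + 1) - g a) := rfl

theorem qDiff_pow_succ (p : F) (n : ℕ) (g : ℕ → E) :
    (qDiff p E ^ (n + 1)) g = (qDiff p E ^ n) (qDiff p E g) := by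
  rw [pow_succ]; rfl

theorem qDiff_pow_succ' (p : F) (n : ℕ) (g : ℕ → E) :
    (qDiff p E ^ (n + 1)) g = qDiff p E ((qDiff p E ^ n) g) := by
  rw [pow_succ']; rfl

theorem quasiCommutative_qDiff_pow (p : F) {b : LaurentHom F K L} (n : ℕ)
    {g : ℕ → LaurentHom F L L} (hg : ∀ k, QuasiCommutative [g k] b) (a : ℕ) :
    QuasiCommutative [(qDiff p _ ^ n) g a] b := by
  induction n generalizing g with
  | zero => exact hg a
  | succ n ih =>
    rw [qDiff_pow_succ]
    exact ih fun k => ((hg _).sub_left (hg _)).smul_left _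

theorem mulField_qDiff_pow (p : F) {b : LaurentHom F K L} (n : ℕ)
    {g : ℕ → LaurentHom F L L} (hg : ∀ k, QuasiCommutative [g k] b) (a : ℕ) :
    mulField ((qDiff p _ ^ n) g a) b = (qDiff p _ ^ n) (fun k => mulField (g k) b) a := by
  induction n generalizing g with
  | zero => rfl
  | succ n ih =>
    rw [qDiff_pow_succ, qDiff_pow_succ,
      ih (g := qDiff p _ g) fun k => ((hg _).sub_left (hg _)).smul_left _]
    refine congrFun (congrArg _ (funext fun k => ?_)) a
    rw [qDiff_apply, qDiff_apply, mulField_smul_left ((hg _).sub_left (hg _)),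
      mulField_sub_left (hg _) (hg _)]

/-- A linear map applied to all terms of a sequence commutes with the difference operator. -/
theorem map_qDiff_pow (p : F) {E' : Type*} [AddCommGroup E'] [Module F E'] (φ : E →ₗ[F] E')
    (n : ℕ) (g : ℕ → E) (a : ℕ) :
    φ ((qDiff p E ^ n) g a) = (qDiff p E' ^ n) (fun k => φ (g k)) a := by
  induction n generalizing g with
  | zero => rfl
  | succ n ih =>
    rw [qDiff_pow_succ, qDiff_pow_succ, ih]
    refine congrFun (congrArg _ (funext fun k => ?_)) a
    rw [qDiff_apply, qDiff_apply, map_smul, map_sub]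

end Pairs

/-! ### Vertex operators -/

section VertexOp

variable {i i' i'' : Fin 2}

theorem mode_vertexOp (c d : ℕ+ → QField) (s : ℤ → QField) (m : ℤ → ℤ) (t n k : ℤ) (f : Heis) :
    mode (vertexOp i i' c d s m t) n (Finsupp.single k f) =
      s k • Finsupp.single (k + t) (expMode c d (n - m k) f) := by
  rw [mode_apply, vertexOp, Finsupp.lsum_single, ← mode_apply, mode_ofModes]
  rfl

theorem ext_mode_single {A B : LaurentHom QField (FockSpace i) (FockSpace i')}
    (h : ∀ n k f, mode A n (Finsupp.single k f) = mode B n (Finsupp.single k f)) : A = B := by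
  refine ext_mode fun n v => LinearMap.congr_fun (?_ : mode A n = mode B n) v
  refine Finsupp.lhom_ext fun k f => h n k f

theorem smul_vertexOp (x : QField) (c d : ℕ+ → QField) (s : ℤ → QField) (m : ℤ → ℤ) (t : ℤ) :
    x • vertexOp i i' c d s m t = vertexOp i i' c d (fun k => x * s k) m t := by
  refine ext_mode_single fun n k f => ?_
  rw [mode_smul_apply, mode_vertexOp, mode_vertexOp, smul_smul]

theorem vertexOp_zero (c d : ℕ+ → QField) (m : ℤ → ℤ) (t : ℤ) :
    vertexOp i i' c d (fun _ => 0) m t = 0 := by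
  refine ext_mode_single fun n k f => ?_
  rw [mode_vertexOp, zero_smul, mode_zero_apply]

theorem rescale_vertexOp {p : QField} (hp : p ≠ 0) (a : ℕ) (c d : ℕ+ → QField) (s : ℤ → QField)
    (m : ℤ → ℤ) (t : ℤ) :
    rescale p a (vertexOp i i' c d s m t) =
      vertexOp i i' (fun r => (p ^ a) ^ (r : ℕ) * c r) (fun r => (p ^ a)⁻¹ ^ (r : ℕ) * d r)
        (fun k => p ^ (a * m k) * s k) m t := by
  refine ext_mode_single fun n k f => ?_
  rw [mode_rescale, mode_vertexOp, mode_vertexOp, expMode_rescale c d (pow_ne_zero a hp),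
    LinearMap.smul_apply, ← Finsupp.smul_single, smul_smul, smul_smul]
  congr 1
  rw [← zpow_natCast, ← zpow_mul, mul_right_comm, ← zpow_add₀ hp]
  congr 2
  ring

theorem mode_vertexOp_vertexOp (c d c' d' : ℕ+ → QField) (s s' : ℤ → QField) (m m' : ℤ → ℤ)
    (t t' n n' k : ℤ) (f : Heis) :
    mode (vertexOp i' i'' c d s m t) n
      (mode (vertexOp i i' c' d' s' m' t') n' (Finsupp.single k f)) =
      (s' k * s (k + t')) • Finsupp.single (k + (t + t'))
        (expMode c d (n - m (k + t')) (expMode c' d' (n' - m' k) f)) := by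
  rw [mode_vertexOp, map_smul, mode_vertexOp, smul_smul, add_assoc, add_comm t' t]

theorem quasiCommutative_vertexOp {c d c' d' : ℕ+ → QField} {P : Polynomial QField}
    (hP : IsContraction d c' P) (s s' : ℤ → QField) (m m' : ℤ → ℤ) (t t' : ℤ) :
    QuasiCommutative [vertexOp i' i' c d s m t] (vertexOp i i' c' d' s' m' t') := by
  rw [quasiCommutative_singleton_iff]
  intro v
  induction v using Finsupp.induction_linear with
  | zero => exact ⟨0, fun _ _ _ => by simp⟩
  | add v w hv hw =>
    obtain ⟨N, hN⟩ := hv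
    obtain ⟨N', hN'⟩ := hw
    refine ⟨min N N', fun j n h => ?_⟩
    rw [map_add, map_add, hN j n (by omega), hN' j n (by omega), add_zero]
  | single k f =>
    obtain ⟨N, hN⟩ := exists_expMode_expMode_eq_zero (c := c) (d' := d') hP f
    refine ⟨N + min (m (k + t')) (m' k), fun j n h => ?_⟩
    rw [mode_vertexOp_vertexOp, hN _ _ (by omega), Finsupp.single_zero, smul_zero]

/-- The product of two vertex operators at the same point is the normally ordered one, multiplied
by the value of the contraction at `w/z = 1`. -/
theorem mulField_vertexOp {c d c' d' : ℕ+ → QField} {P : Polynomial QField}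
    (hP : IsContraction d c' P) (s s' : ℤ → QField) (m m' : ℤ → ℤ) (t t' : ℤ) :
    mulField (vertexOp i' i' c d s m t) (vertexOp i i' c' d' s' m' t') =
      vertexOp i i' (c + c') (d + d') (fun k => s' k * s (k + t') * P.eval 1)
        (fun k => m (k + t') + m' k) (t + t') := by
  refine ext_mode_single fun n k f => ?_
  rw [mode_mulField (quasiCommutative_vertexOp hP s s' m m' t t'), mode_vertexOp]
  simp_rw [mode_vertexOp_vertexOp]
  rw [← smul_finsum, mul_smul _ (P.eval 1), Finsupp.smul_single (P.eval 1),
    ← finsum_expMode_expMode hP]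
  congr 1
  obtain ⟨N, hN⟩ := exists_expMode_expMode_eq_zero (c := c) (d' := d') hP f
  have hfin : (Function.support fun j : ℤ => expMode c d j
      (expMode c' d' (n - (m (k + t') + m' k) - j) f)).Finite := by
    refine (Set.finite_Icc N (n - (m (k + t') + m' k) - N)).subset fun j hj => ?_
    by_contra hc
    rw [Set.mem_Icc, not_and_or, not_le, not_le] at hc
    exact hj (hN _ _ (by omega))
  have h := map_finsum (Finsupp.lsingle (R := QField) (M := Heis) (k + (t + t'))) hfin
  rw [Finsupp.lsingle_apply] at h
  rw [h]
  refine (finsum_congr fun j => ?_).trans (finsum_comp_equiv (Equiv.subRight (m (k + t'))))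
  rw [Equiv.subRight_apply, Finsupp.lsingle_apply]
  congr 4
  ring

end VertexOp

/-! ### The ground field -/

theorem qHalf_pow_injective : Function.Injective fun n : ℕ => qHalf ^ n := by
  intro m n h
  simp only [qHalf, ← RatFunc.algebraMap_X, ← map_pow] at h
  have h' := congrArg Polynomial.natDegree (RatFunc.algebraMap_injective ℂ h)
  simpa using h'

theorem qHalf_ne_zero : qHalf ≠ 0 := RatFunc.X_ne_zero

theorem qq_ne_zero : qq ≠ 0 := pow_ne_zero _ qHalf_ne_zero

theorem qPar_ne_zero : qPar ≠ 0 := pow_ne_zero _ qq_ne_zero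

theorem qPar_pow (n : ℕ) : qPar ^ n = qHalf ^ (4 * n) := by
  rw [qPar, qq, ← pow_mul, ← pow_mul]
  congr 1
  ring

theorem qPar_pow_eq_one {n : ℕ} (h : qPar ^ n = 1) : n = 0 := by
  rw [qPar_pow, ← pow_zero qHalf] at h
  have := qHalf_pow_injective h
  omega

theorem qPar_zpow_eq_one {n : ℤ} (h : qPar ^ n = 1) : n = 0 := by
  rcases Int.natAbs_eq n with hn | hn
  · rw [hn, zpow_natCast] at h
    have := qPar_pow_eq_one h
    omega
  · rw [hn, zpow_neg, inv_eq_one, zpow_natCast] at h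
    have := qPar_pow_eq_one h
    omega

theorem qPar_sub_one_ne_zero : qPar - 1 ≠ 0 := by
  intro h
  have := qPar_pow_eq_one (n := 1) (by rw [pow_one]; exact sub_eq_zero.mp h)
  omega

theorem qNum_ne_zero {n : ℤ} (h : n ≠ 0) : qNum qPar n ≠ 0 :=
  div_ne_zero (fun h' => h (qPar_zpow_eq_one (sub_eq_zero.mp h'))) qPar_sub_one_ne_zero

theorem qFact_ne_zero (n : ℕ) : qFact qPar n ≠ 0 :=
  Finset.prod_ne_zero_iff.mpr fun j _ => qNum_ne_zero (by omega)

theorem qq_pow_sub_inv_ne_zero {n : ℕ} (h : n ≠ 0) : qq ^ n - (qq ^ n)⁻¹ ≠ 0 := by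
  intro h'
  have h0 : qq ^ n ≠ 0 := pow_ne_zero _ qq_ne_zero
  have h1 : qPar ^ n = 1 := by
    rw [qPar, ← pow_mul, mul_comm, pow_mul, sq]
    nth_rw 2 [sub_eq_zero.mp h']
    exact mul_inv_cancel₀ h0
  exact h (qPar_pow_eq_one h1)

theorem qInt_ne_zero {n : ℕ} (h : n ≠ 0) : qInt n ≠ 0 := by
  refine div_ne_zero (qq_pow_sub_inv_ne_zero h) ?_
  simpa using qq_pow_sub_inv_ne_zero one_ne_zero

theorem qInt_two_mul (n : ℕ) : qInt (2 * n) = qInt n * (qq ^ n + (qq ^ n)⁻¹) := by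
  have h0 : qq ^ n ≠ 0 := pow_ne_zero _ qq_ne_zero
  rw [qInt, qInt, mul_comm 2 n, pow_mul, div_mul_eq_mul_div]
  congr 1
  field_simp
  ring

/-! ### Contractions of the Frenkel–Jing and Koyama operators -/

/-- The coefficient `q ^ (-r/2) / [r]` of `a(-r)` in the Frenkel–Jing operator. -/
def xCoeff (r : ℕ+) : QField := (qHalf ^ (r : ℕ))⁻¹ / qInt r

/-- The coefficient `q ^ (r/2) / [2r]` of `a(-r)` in Koyama's operator. -/
def yCoeff (r : ℕ+) : QField := qHalf ^ (r : ℕ) / qInt (2 * r)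

/-- The polynomial `P` has constant term `1` and `w P'(w) / P(w) = ∑ g_r w ^ r`. -/
def HasLogDeriv (g : ℕ+ → QField) (P : Polynomial QField) : Prop :=
  P.coeff 0 = 1 ∧ euler (P : PowerSeries QField) = scalarSeries g * (P : PowerSeries QField)

theorem HasLogDeriv.mul {g h : ℕ+ → QField} {P Q : Polynomial QField} (hP : HasLogDeriv g P)
    (hQ : HasLogDeriv h Q) : HasLogDeriv (g + h) (P * Q) := by
  refine ⟨by rw [Polynomial.mul_coeff_zero, hP.1, hQ.1, one_mul], ?_⟩
  have hadd : scalarSeries (g + h) = scalarSeries g + scalarSeries h := by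
    ext1 n
    obtain rfl | ⟨r, rfl⟩ := eq_zero_or_eq_pnat n
    · simp only [map_add, coeff_zero_scalarSeries, add_zero]
    · simp only [map_add, coeff_scalarSeries, Pi.add_apply]
  rw [Polynomial.coe_mul, euler_mul, hP.2, hQ.2, hadd]
  ring

theorem hasLogDeriv_linear (a : QField) :
    HasLogDeriv (fun r => -a ^ (r : ℕ)) (1 - Polynomial.C a * Polynomial.X) := by
  refine ⟨by simp, ?_⟩
  ext1 n
  simp only [Polynomial.coe_sub, Polynomial.coe_one, Polynomial.coe_mul, Polynomial.coe_C,
    Polynomial.coe_X, mul_sub, mul_one, map_sub, euler_sub, coeff_euler]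
  rw [mul_left_comm, PowerSeries.coeff_C_mul, PowerSeries.coeff_C_mul]
  rcases n with _ | n
  · simp [coeff_zero_scalarSeries]
  · rw [PowerSeries.coeff_succ_mul_X, PowerSeries.coeff_one, if_neg (Nat.succ_ne_zero n),
      PowerSeries.coeff_X]
    have h := coeff_scalarSeries (fun r => -a ^ (r : ℕ)) ⟨n + 1, Nat.succ_pos n⟩
    simp only [PNat.mk_coe] at h
    rw [h]
    rcases n with _ | n
    · simp [coeff_zero_scalarSeries]
    · have h' := coeff_scalarSeries (fun r => -a ^ (r : ℕ)) ⟨n + 1, Nat.succ_pos n⟩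
      simp only [PNat.mk_coe] at h'
      rw [h', if_neg (by omega)]
      simp [pow_succ' a (n + 1)]

/-- The logarithm of the contraction of `x(z p ^ k)` and `x(w p ^ s)` is
`log (1 - p ^ (s-k) w/z) + log (1 - p ^ (s-k-1) w/z)`. -/
theorem contraction_xCoeff_xCoeff (k s : ℕ) (r : ℕ+) :
    (r : QField) * (heisScalar r * ((qPar ^ k)⁻¹ ^ (r : ℕ) * -xCoeff r) *
      ((qPar ^ s) ^ (r : ℕ) * xCoeff r)) =
      -(qPar ^ ((s : ℤ) - k)) ^ (r : ℕ) + -(qPar ^ ((s : ℤ) - k - 1)) ^ (r : ℕ) := by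
  have hr : (r : QField) ≠ 0 := Nat.cast_ne_zero.mpr r.ne_zero
  have h1 := qInt_ne_zero r.ne_zero
  have hH : qHalf ^ (r : ℕ) ≠ 0 := pow_ne_zero _ qHalf_ne_zero
  have hp := qPar_ne_zero
  have hq : qq ^ (r : ℕ) = (qHalf ^ (r : ℕ)) ^ 2 := by rw [qq, ← pow_mul, ← pow_mul, mul_comm]
  have hP : qPar ^ (r : ℕ) = (qHalf ^ (r : ℕ)) ^ 4 := by rw [qPar_pow, ← pow_mul, mul_comm]
  rw [heisScalar, xCoeff, qInt_two_mul, hq, zpow_sub_one₀ hp, zpow_sub₀ hp, zpow_natCast,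
    zpow_natCast, mul_pow, inv_pow qPar, hP]
  field_simp
  ring

/-- The logarithm of the contraction of `x(z p ^ k)` and `𝒴(w p ^ N)` is
`log (1 - p ^ (N-k) w/z)`. -/
theorem contraction_xCoeff_yCoeff (k N : ℕ) (r : ℕ+) :
    (r : QField) * (heisScalar r * ((qPar ^ k)⁻¹ ^ (r : ℕ) * -xCoeff r) *
      ((qPar ^ N) ^ (r : ℕ) * yCoeff r)) = -(qPar ^ ((N : ℤ) - k)) ^ (r : ℕ) := by
  have hr : (r : QField) ≠ 0 := Nat.cast_ne_zero.mpr r.ne_zero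
  have h1 := qInt_ne_zero r.ne_zero
  have h2 := qInt_ne_zero (mul_ne_zero two_ne_zero r.ne_zero)
  have hH : qHalf ^ (r : ℕ) ≠ 0 := pow_ne_zero _ qHalf_ne_zero
  have hp := qPar_ne_zero
  rw [heisScalar, xCoeff, yCoeff, zpow_sub₀ hp, zpow_natCast, zpow_natCast]
  field_simp
  rw [div_pow, div_pow, one_pow]
  ring

/-! ### Normally ordered products at the points `z p ^ k` -/

/-- The coefficients of the `a(-r) z ^ r` in `x(z p ^ {s_m}) ⋯ x(z p ^ {s_1}) 𝒴(z p ^ N)`, for the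
list `[s_m, …, s_1]`. -/
def creationCoeff : List ℕ → ℕ → ℕ+ → QField
  | [], N => fun r : ℕ+ => (qPar ^ N) ^ (r : ℕ) * yCoeff r
  | s :: S, N => (fun r : ℕ+ => (qPar ^ s) ^ (r : ℕ) * xCoeff r) + creationCoeff S N

/-- The coefficients of the `a(r) z ^ (-r)` in `x(z p ^ {s_m}) ⋯ x(z p ^ {s_1}) 𝒴(z p ^ N)`. -/
def annihilationCoeff : List ℕ → ℕ → ℕ+ → QField
  | [], N => fun r : ℕ+ => (qPar ^ N)⁻¹ ^ (r : ℕ) * -yCoeff r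
  | s :: S, N => (fun r : ℕ+ => (qPar ^ s)⁻¹ ^ (r : ℕ) * -xCoeff r) + annihilationCoeff S N

/-- The contraction of `x(z p ^ k)` with `x(w p ^ {s_m}) ⋯ x(w p ^ {s_1}) 𝒴(w p ^ N)`, a polynomial
in `w/z`. -/
def contraction (k : ℕ) : List ℕ → ℕ → Polynomial QField
  | [], N => 1 - Polynomial.C (qPar ^ ((N : ℤ) - k)) * Polynomial.X
  | s :: S, N => (1 - Polynomial.C (qPar ^ ((s : ℤ) - k)) * Polynomial.X) *
      (1 - Polynomial.C (qPar ^ ((s : ℤ) - k - 1)) * Polynomial.X) * contraction k S N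

/-- The scalar with which `x(z p ^ {s_m}) ⋯ x(z p ^ {s_1}) 𝒴(z p ^ N)` acts on `e^{j α}`. -/
def productScalar : List ℕ → ℕ → ℤ → QField
  | [], N => fun j => qPar ^ ((N : ℤ) * j) * (-1) ^ j
  | s :: S, N => fun j => productScalar S N j * qPar ^ ((s : ℤ) * (2 * (j + S.length) + 1)) *
      (contraction s S N).eval 1

/-- The power of `z` with which a product of `x`'s, one for each entry of the list, and `𝒴` acts on
`e^{j α}`. -/
def productExponent : List ℕ → ℤ → ℤ
  | [] => fun j => j
  | _ :: S => fun j => 2 * (j + S.length) + 1 + productExponent S j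

/-- `z ^ e x(z p ^ k)` on `L_1`. -/
def xShift (k : ℕ) (e : ℤ) : LaurentHom QField (FockSpace 1) (FockSpace 1) :=
  vertexOp 1 1 (fun r => (qPar ^ k) ^ (r : ℕ) * xCoeff r)
    (fun r => (qPar ^ k)⁻¹ ^ (r : ℕ) * -xCoeff r)
    (fun j => qPar ^ ((k : ℤ) * (2 * j + 1))) (fun j => 2 * j + 1 + e) 1

/-- `z ^ e x(z p ^ {s_m}) ⋯ x(z p ^ {s_1}) 𝒴(z p ^ N)` for the list `[s_m, …, s_1]`. -/
def pointProduct (S : List ℕ) (N : ℕ) (e : ℤ) :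
    LaurentHom QField (FockSpace 0) (FockSpace 1) :=
  vertexOp 0 1 (creationCoeff S N) (annihilationCoeff S N) (productScalar S N)
    (fun j => productExponent S j + e) S.length

theorem isContraction_contraction (k : ℕ) (S : List ℕ) (N : ℕ) :
    IsContraction (fun r => (qPar ^ k)⁻¹ ^ (r : ℕ) * -xCoeff r) (creationCoeff S N)
      (contraction k S N) := by
  change HasLogDeriv _ _
  induction S with
  | nil =>
    convert hasLogDeriv_linear (qPar ^ ((N : ℤ) - k)) using 1
    · funext r
      exact contraction_xCoeff_yCoeff k N r
    · rfl
  | cons s S ih =>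
    convert ((hasLogDeriv_linear (qPar ^ ((s : ℤ) - k))).mul
      (hasLogDeriv_linear (qPar ^ ((s : ℤ) - k - 1)))).mul ih using 1
    · funext r
      simp only [Pi.add_apply, creationCoeff]
      rw [mul_add, mul_add, contraction_xCoeff_xCoeff]
    · rfl

theorem quasiCommutative_xShift (k : ℕ) (e : ℤ) (S : List ℕ) (N : ℕ) (e' : ℤ) :
    QuasiCommutative [xShift k e] (pointProduct S N e') :=
  quasiCommutative_vertexOp (isContraction_contraction k S N) _ _ _ _ _ _

theorem mulField_xShift (k : ℕ) (e : ℤ) (S : List ℕ) (N : ℕ) (e' : ℤ) :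
    mulField (xShift k e) (pointProduct S N e') = pointProduct (k :: S) N (e + e') := by
  rw [xShift, pointProduct, mulField_vertexOp (isContraction_contraction k S N), pointProduct]
  congr 1
  · funext j
    simp only [productExponent]
    ring
  · rw [List.length_cons]
    push_cast
    ring

theorem contraction_map_add (k a : ℕ) (S : List ℕ) (N : ℕ) :
    contraction (k + a) (S.map (· + a)) (N + a) = contraction k S N := by
  induction S with
  | nil => simp [contraction]
  | cons s S ih => simp [contraction, ih]

theorem creationCoeff_map_add (a : ℕ) (S : List ℕ) (N : ℕ) :
    creationCoeff (S.map (· + a)) (N + a) =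
      fun r : ℕ+ => (qPar ^ a) ^ (r : ℕ) * creationCoeff S N r := by
  induction S with
  | nil => funext r; simp only [List.map_nil, creationCoeff, pow_add, mul_pow]; ring
  | cons s S ih =>
    funext r
    simp only [List.map_cons, creationCoeff, ih, pow_add, mul_pow, Pi.add_apply]
    ring

theorem annihilationCoeff_map_add (a : ℕ) (S : List ℕ) (N : ℕ) :
    annihilationCoeff (S.map (· + a)) (N + a) =
      fun r : ℕ+ => (qPar ^ a)⁻¹ ^ (r : ℕ) * annihilationCoeff S N r := by
  induction S with
  | nil => funext r; simp only [List.map_nil, annihilationCoeff, pow_add, mul_pow, mul_inv]; ring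
  | cons s S ih =>
    funext r
    simp only [List.map_cons, annihilationCoeff, ih, pow_add, mul_pow, mul_inv, Pi.add_apply]
    ring

theorem productExponent_map_add (a : ℕ) (S : List ℕ) (j : ℤ) :
    productExponent (S.map (· + a)) j = productExponent S j := by
  induction S with
  | nil => rfl
  | cons s S ih => simp only [List.map_cons, productExponent, List.length_map, ih]

theorem productScalar_map_add (a : ℕ) (S : List ℕ) (N : ℕ) (j : ℤ) :
    productScalar (S.map (· + a)) (N + a) j =
      qPar ^ (a * productExponent S j) * productScalar S N j := by
  have hp := qPar_ne_zero
  induction S with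
  | nil =>
    simp only [List.map_nil, productScalar, productExponent, Nat.cast_add, add_mul, zpow_add₀ hp]
    ring
  | cons s S ih =>
    simp only [List.map_cons, productScalar, productExponent, Nat.cast_add, List.length_map,
      contraction_map_add, ih]
    rw [mul_add (a : ℤ) (2 * (j + S.length) + 1), zpow_add₀ hp, add_mul (s : ℤ), zpow_add₀ hp]
    ring

theorem rescale_pointProduct (a : ℕ) (S : List ℕ) (N : ℕ) (e : ℤ) :
    rescale qPar a (pointProduct S N e) =
      qPar ^ (a * e) • pointProduct (S.map (· + a)) (N + a) e := by
  rw [pointProduct, rescale_vertexOp qPar_ne_zero, pointProduct, smul_vertexOp,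
    creationCoeff_map_add, annihilationCoeff_map_add, List.length_map]
  congr 1
  · funext j
    rw [productScalar_map_add, mul_add, zpow_add₀ qPar_ne_zero]
    ring
  · funext j
    rw [productExponent_map_add]

theorem frenkelJing_eq : frenkelJing 1 = xShift 0 0 := by
  rw [frenkelJing, xShift]
  congr 1
  · funext r; simp [xCoeff]
  · funext r; simp [xCoeff]
  · funext j; simp
  · funext j; simp

theorem koyama_eq : koyama = pointProduct [] 0 0 := by
  rw [koyama, pointProduct]
  congr 1
  · funext r; simp [creationCoeff, yCoeff]
  · funext r; simp [annihilationCoeff, yCoeff]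
  · funext j; simp [productScalar]
  · funext j; simp [productExponent]

/-! ### The Leibniz rule for the difference operator -/

section Leibniz

variable {F : Type*} [Field F] {E : Type*} [AddCommGroup E] [Module F E]

theorem qNum_add {p : F} (h0 : p ≠ 0) (a b : ℕ) :
    qNum p ((a + b : ℕ) : ℤ) = qNum p a + p ^ a * qNum p b := by
  rw [qNum, qNum, qNum, Nat.cast_add, zpow_add₀ h0, mul_div_assoc', ← add_div, zpow_natCast,
    zpow_natCast]
  congr 1
  ring

theorem qFact_succ (p : F) (n : ℕ) : qFact p (n + 1) = qFact p n * qNum p ((n + 1 : ℕ) : ℤ) := by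
  rw [qFact, Finset.prod_range_succ]
  push_cast
  rfl

/-- The iterated partial differences of a double sequence. -/
def mixedDiff (p : F) (Φ : ℕ → ℕ → E) (n n' : ℕ) : ℕ → ℕ → E :=
  (qDiff p (ℕ → E) ^ n) fun k => (qDiff p E ^ n') (Φ k)

theorem mixedDiff_succ_left (p : F) (Φ : ℕ → ℕ → E) (n n' a b : ℕ) :
    mixedDiff p Φ (n + 1) n' a b =
      (p ^ a)⁻¹ • (mixedDiff p Φ n n' (a + 1) b - mixedDiff p Φ n n' a b) := by
  rw [mixedDiff, qDiff_pow_succ']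
  rfl

theorem mixedDiff_succ_right (p : F) (Φ : ℕ → ℕ → E) (n n' a b : ℕ) :
    mixedDiff p Φ n (n' + 1) a b =
      (p ^ b)⁻¹ • (mixedDiff p Φ n n' a (b + 1) - mixedDiff p Φ n n' a b) := by
  rw [← qDiff_apply p (mixedDiff p Φ n n' a), mixedDiff, mixedDiff, map_qDiff_pow]
  simp_rw [qDiff_pow_succ']

theorem mixedDiff_qDiff (p : F) (Φ : ℕ → ℕ → E) (n n' : ℕ) :
    mixedDiff p (fun k => qDiff p E (Φ k)) n n' = mixedDiff p Φ n (n' + 1) := by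
  rw [mixedDiff, mixedDiff]
  simp_rw [qDiff_pow_succ]

theorem qDiff_diagonal_mixedDiff {p : F} (h0 : p ≠ 0) (Φ : ℕ → ℕ → E) (n n' a : ℕ) :
    qDiff p E (fun a => mixedDiff p Φ n n' a (a + n)) a =
      mixedDiff p Φ (n + 1) n' a (a + (n + 1)) + p ^ n • mixedDiff p Φ n (n' + 1) a (a + n) := by
  rw [qDiff_apply, mixedDiff_succ_left, mixedDiff_succ_right, smul_smul, pow_add, mul_inv_rev,
    ← mul_assoc, mul_inv_cancel₀ (pow_ne_zero n h0), one_mul, ← smul_add]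
  rw [show a + 1 + n = a + (n + 1) by ring, show a + n + 1 = a + (n + 1) by ring]
  congr 1
  abel

/-- The Leibniz rule: the iterated differences of the diagonal of a double sequence. The shift by
`n` in the second argument comes from the noncommutativity of shifts and differences. -/
theorem qDiff_pow_diagonal {p : F} (h0 : p ≠ 0) (hp : ∀ n : ℕ, qNum p ((n + 1 : ℕ) : ℤ) ≠ 0)
    (Φ : ℕ → ℕ → E) (m a : ℕ) :
    (qDiff p E ^ m) (fun a => Φ a a) a = qFact p m •
      ∑ x ∈ Finset.HasAntidiagonal.antidiagonal m,
        (qFact p x.1 * qFact p x.2)⁻¹ • mixedDiff p Φ x.1 x.2 a (a + x.1) := by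
  have hF : ∀ n, qFact p n ≠ 0 := fun n =>
    Finset.prod_ne_zero_iff.mpr fun j _ => by exact_mod_cast hp j
  induction m generalizing a with
  | zero => simp [mixedDiff, qFact]
  | succ m ih =>
    have ih' : (qDiff p E ^ m) (fun a => Φ a a) = fun a => qFact p m •
      ∑ x ∈ Finset.HasAntidiagonal.antidiagonal m,
        (qFact p x.1 * qFact p x.2)⁻¹ • mixedDiff p Φ x.1 x.2 a (a + x.1) := funext ih
    have hlin : qDiff p E ((qDiff p E ^ m) (fun a => Φ a a)) a = qFact p m •
        ∑ x ∈ Finset.HasAntidiagonal.antidiagonal m, (qFact p x.1 * qFact p x.2)⁻¹ •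
          qDiff p E (fun a => mixedDiff p Φ x.1 x.2 a (a + x.1)) a := by
      rw [ih', qDiff_apply]
      simp_rw [qDiff_apply, ← smul_sub, ← Finset.sum_sub_distrib, ← smul_sub]
      rw [smul_comm, Finset.smul_sum]
      simp_rw [smul_comm (p ^ a)⁻¹]
    -- The coefficients satisfy the recursion `[a + b] = [a] + p ^ a [b]`.
    have hsplit : ∀ y ∈ Finset.HasAntidiagonal.antidiagonal (m + 1),
        qNum p ((m + 1 : ℕ) : ℤ) • (qFact p y.1 * qFact p y.2)⁻¹ •
          mixedDiff p Φ y.1 y.2 a (a + y.1) =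
        (qNum p y.1 * (qFact p y.1 * qFact p y.2)⁻¹) • mixedDiff p Φ y.1 y.2 a (a + y.1) +
        (p ^ y.1 * qNum p y.2 * (qFact p y.1 * qFact p y.2)⁻¹) •
          mixedDiff p Φ y.1 y.2 a (a + y.1) := by
      intro y hy
      rw [← Finset.HasAntidiagonal.mem_antidiagonal.mp hy, qNum_add h0, smul_smul, ← add_smul,
        ← add_mul]
    rw [qDiff_pow_succ', hlin, qFact_succ, mul_smul, Finset.smul_sum (r := qNum p _),
      Finset.sum_congr rfl hsplit, Finset.sum_add_distrib, Finset.Nat.sum_antidiagonal_succ,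
      Finset.Nat.sum_antidiagonal_succ' (f := fun y : ℕ × ℕ =>
        (p ^ y.1 * qNum p y.2 * (qFact p y.1 * qFact p y.2)⁻¹) •
          mixedDiff p Φ y.1 y.2 a (a + y.1))]
    have hz : qNum p ((0 : ℕ) : ℤ) = 0 := by simp [qNum]
    simp only [hz, zero_mul, mul_zero, zero_smul, zero_add]
    rw [← Finset.sum_add_distrib]
    congr 1
    refine Finset.sum_congr rfl fun x _ => ?_
    rw [qDiff_diagonal_mixedDiff h0, smul_add, smul_smul, qFact_succ, qFact_succ]
    have h1 := hF x.1
    have h2 := hF x.2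
    have h3 := hp x.1
    have h4 := hp x.2
    congr 2 <;> field_simp

theorem qDiff_pow_shift {p : F} (h0 : p ≠ 0) (g : ℕ → E) (n m a : ℕ) :
    (qDiff p E ^ m) (fun k => g (k + n)) a = p ^ (n * m) • (qDiff p E ^ m) g (a + n) := by
  induction m generalizing a with
  | zero => simp
  | succ m ih =>
    rw [qDiff_pow_succ', qDiff_pow_succ', qDiff_apply, qDiff_apply, ih, ih, ← smul_sub, smul_smul,
      smul_smul, add_right_comm]
    congr 1
    have := pow_ne_zero a h0
    have := pow_ne_zero n h0
    field_simp
    ring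

/-- An iterated difference expands into the values, with nonzero leading coefficient. -/
theorem exists_qDiff_pow_sub_mem {p : F} (h0 : p ≠ 0) (g : ℕ → E) (n a : ℕ) :
    ∃ c : F, c ≠ 0 ∧ (qDiff p E ^ n) g a - c • g a ∈
      Submodule.span F (g '' {k | a < k ∧ k ≤ a + n}) := by
  induction n generalizing a with
  | zero => exact ⟨1, one_ne_zero, by simp⟩
  | succ n ih =>
    obtain ⟨c, hc, h⟩ := ih a
    obtain ⟨c', -, h'⟩ := ih (a + 1)
    have hpa : (p ^ a)⁻¹ ≠ 0 := inv_ne_zero (pow_ne_zero a h0)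
    refine ⟨-((p ^ a)⁻¹ * c), neg_ne_zero.mpr (mul_ne_zero hpa hc), ?_⟩
    have e : (qDiff p E ^ (n + 1)) g a - -((p ^ a)⁻¹ * c) • g a =
        (p ^ a)⁻¹ • (((qDiff p E ^ n) g (a + 1) - c' • g (a + 1)) + c' • g (a + 1) -
          ((qDiff p E ^ n) g a - c • g a)) := by
      rw [qDiff_pow_succ', qDiff_apply]
      module
    rw [e]
    refine Submodule.smul_mem _ _ (Submodule.sub_mem _ (Submodule.add_mem _ ?_ ?_) ?_)
    · refine Submodule.span_mono (Set.image_mono ?_) h'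
      rintro k ⟨h1, h2⟩
      exact ⟨by omega, by omega⟩
    · exact Submodule.smul_mem _ _ (Submodule.subset_span ⟨a + 1, ⟨by omega, by omega⟩, rfl⟩)
    · refine Submodule.span_mono (Set.image_mono ?_) h
      rintro k ⟨h1, h2⟩
      exact ⟨h1, by omega⟩

end Leibniz

/-! ### The action of the `n`-th products with the Frenkel–Jing operator -/

theorem mode_xShift (k : ℕ) (e n : ℤ) (v : FockSpace 1) :
    mode (xShift k e) n v = qPar ^ ((k : ℤ) * (n - e)) • mode (xShift 0 0) (n - e) v := by
  refine LinearMap.congr_fun (?_ : mode (xShift k e) n =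
    qPar ^ ((k : ℤ) * (n - e)) • mode (xShift 0 0) (n - e)) v
  refine Finsupp.lhom_ext fun j f => ?_
  rw [LinearMap.smul_apply, xShift, xShift, mode_vertexOp, mode_vertexOp,
    expMode_rescale _ _ (pow_ne_zero k qPar_ne_zero)]
  simp only [pow_zero, one_pow, inv_one, one_mul, Nat.cast_zero, zero_mul, zpow_zero, one_smul,
    LinearMap.smul_apply, ← Finsupp.smul_single, smul_smul]
  rw [← zpow_natCast, ← zpow_mul, ← zpow_add₀ qPar_ne_zero]
  congr 2
  · ring
  · congr 2; ring

/-- The iterated `p`-derivative is `(z (p - 1)) ^ (-n)` times the `n`-th difference of the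
`x(z p ^ k)`. -/
theorem iterate_qDeriv_frenkelJing (n : ℕ) :
    (qDeriv qPar)^[n] (frenkelJing 1) =
      (qPar - 1)⁻¹ ^ n • (qDiff qPar _ ^ n) (fun k => xShift k (-n)) 0 := by
  have hp := qPar_ne_zero
  -- The difference operator maps the characters `k ↦ p ^ (k j)` to multiples of each other.
  have hchar : ∀ (j : ℤ) (w : FockSpace 1),
      qDiff qPar _ (fun k : ℕ => qPar ^ ((k : ℤ) * j) • w) =
        (qPar ^ j - 1) • fun k : ℕ => qPar ^ ((k : ℤ) * (j - 1)) • w := by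
    intro j w
    funext a
    rw [qDiff_apply, Pi.smul_apply, ← sub_smul, smul_smul, smul_smul]
    congr 1
    rw [Nat.cast_add, Nat.cast_one, add_mul, one_mul, zpow_add₀ hp,
      show (a : ℤ) * (j - 1) = a * j - a by ring, zpow_sub₀ hp, zpow_natCast]
    field_simp
  have hpow : ∀ (m : ℕ) (j : ℤ) (w : FockSpace 1), ∃ c : QField,
      (qDiff qPar _ ^ m) (fun k : ℕ => qPar ^ ((k : ℤ) * j) • w) =
        c • fun k : ℕ => qPar ^ ((k : ℤ) * (j - m)) • w := by
    intro m j w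
    induction m with
    | zero => exact ⟨1, by simp⟩
    | succ m ih =>
      obtain ⟨c, hc⟩ := ih
      refine ⟨c * (qPar ^ (j - m) - 1), ?_⟩
      rw [qDiff_pow_succ', hc, map_smul, hchar, smul_smul]
      push_cast
      rw [sub_sub]
  have key : ∀ (m : ℕ) (i : ℤ) (v : FockSpace 1), mode ((qDeriv qPar)^[m] (frenkelJing 1)) i v =
      (qPar - 1)⁻¹ ^ m • (qDiff qPar _ ^ m)
        (fun k : ℕ => qPar ^ ((k : ℤ) * (i + m)) • mode (xShift 0 0) (i + m) v) 0 := by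
    intro m
    induction m with
    | zero => intro i v; simp [frenkelJing_eq]
    | succ m ih =>
      intro i v
      rw [Function.iterate_succ_apply', mode_qDeriv, ih, qDiff_pow_succ']
      have e : (i : ℤ) + 1 + m = i + (m + 1 : ℕ) := by push_cast; ring
      rw [e]
      obtain ⟨c, hc⟩ := hpow m (i + (m + 1 : ℕ)) (mode (xShift 0 0) (i + (m + 1 : ℕ)) v)
      rw [hc, map_smul, hchar]
      simp only [Pi.smul_apply, Nat.cast_zero, zero_mul, zpow_zero, one_smul, smul_smul]
      congr 1
      rw [pow_succ, show i + ((m + 1 : ℕ) : ℤ) - m = i + 1 by push_cast; ring]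
      ring
  refine ext_mode fun i v => ?_
  rw [key, mode_smul_apply]
  have h := map_qDiff_pow qPar
    ((HahnSeries.coeff.linearMap (R := QField) i).comp (LinearMap.applyₗ v))
    n (fun k => xShift k (-n)) 0
  congr 1
  refine Eq.trans ?_ h.symm
  refine congrFun (congrArg _ (funext fun k => ?_)) 0
  have h' := mode_xShift k (-n) i v
  rw [sub_neg_eq_add] at h'
  exact h'.symm

/-- Formal linear combinations of the `z ^ e x(z p ^ {s_m}) ⋯ x(z p ^ {s_1}) 𝒴(z p ^ N)`, which are
indexed by the triples `([s_m, …, s_1], N, e)`. -/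
abbrev PointSum : Type := (List ℕ × ℕ × ℤ) →₀ QField

/-- The operator that is given by a formal linear combination. -/
def realize : PointSum →ₗ[QField] LaurentHom QField (FockSpace 0) (FockSpace 1) :=
  Finsupp.linearCombination QField fun x => pointProduct x.1 x.2.1 x.2.2

theorem realize_single (S : List ℕ) (N : ℕ) (e : ℤ) (c : QField) :
    realize (Finsupp.single (S, N, e) c) = c • pointProduct S N e := by
  rw [realize, Finsupp.linearCombination_single]

/-- The scalar in front of the `n`-th difference in the `(-n-1)`-st product. -/
def stepScalar (n : ℕ) : QField := (qFact qPar n)⁻¹ * (qPar - 1)⁻¹ ^ n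

/-- The `(-n-1)`-st product with `x(z)` on formal linear combinations. -/
def step (n : ℕ) : PointSum →ₗ[QField] PointSum :=
  Finsupp.linearCombination QField fun x => (stepScalar n * qPar ^ (n * x.2.2)) •
    (qDiff qPar PointSum ^ n)
      (fun k => Finsupp.single (k :: x.1.map (· + n), x.2.1 + n, x.2.2 - n) 1) 0

theorem step_single (n : ℕ) (S : List ℕ) (N : ℕ) (e : ℤ) :
    step n (Finsupp.single (S, N, e) 1) = (stepScalar n * qPar ^ (n * e)) •
      (qDiff qPar PointSum ^ n)
        (fun k => Finsupp.single (k :: S.map (· + n), N + n, e - n) 1) 0 := by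
  rw [step, Finsupp.linearCombination_single, one_smul]

theorem quasiCommutative_iterate_qDeriv (n : ℕ) (w : PointSum) :
    realize w ∈ quasiCommutant ((qDeriv qPar)^[n] (frenkelJing 1)) := by
  induction w using Finsupp.induction_linear with
  | zero => rw [map_zero]; exact zero_mem _
  | add u v hu hv => rw [map_add]; exact add_mem hu hv
  | single x c =>
    obtain ⟨S, N, e⟩ := x
    rw [realize_single]
    refine Submodule.smul_mem _ _ ?_
    rw [mem_quasiCommutant, iterate_qDeriv_frenkelJing]
    exact (quasiCommutative_qDiff_pow qPar n
      (fun k => quasiCommutative_xShift k (-n) S N e) 0).smul_left _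

theorem exists_rescale_realize (n : ℕ) (w : PointSum) :
    ∃ u, rescale qPar n (realize w) = realize u := by
  induction w using Finsupp.induction_linear with
  | zero => exact ⟨0, ext_mode fun i v => by simp [mode_rescale, mode_zero_apply]⟩
  | add w w' h h' =>
    obtain ⟨u, hu⟩ := h
    obtain ⟨u', hu'⟩ := h'
    exact ⟨u + u', by rw [map_add, rescale_add, hu, hu', map_add]⟩
  | single x c =>
    obtain ⟨S, N, e⟩ := x
    refine ⟨Finsupp.single (S.map (· + n), N + n, e) (c * qPar ^ (n * e)), ?_⟩
    rw [realize_single, realize_single, rescale_smul, rescale_pointProduct, smul_smul]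

/-- The `(-n-1)`-st product with `x(z)`, computed on formal linear combinations. -/
theorem prod_frenkelJing_realize (n : ℕ) (w : PointSum) :
    prod qPar (frenkelJing 1) (Int.negSucc n) (realize w) = realize (step n w) := by
  have hmem : ∀ w : PointSum,
      rescale qPar n (realize w) ∈ quasiCommutant ((qDeriv qPar)^[n] (frenkelJing 1)) := by
    intro w
    obtain ⟨u, hu⟩ := exists_rescale_realize n w
    rw [hu]
    exact quasiCommutative_iterate_qDeriv n u
  have hsmul : ∀ (c : QField) (w : PointSum),
      prod qPar (frenkelJing 1) (Int.negSucc n) (realize (c • w)) =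
        c • prod qPar (frenkelJing 1) (Int.negSucc n) (realize w) := by
    intro c w
    rw [prod_negSucc, prod_negSucc, map_smul, rescale_smul, mulField_smul_right (hmem w), smul_comm]
  induction w using Finsupp.induction_linear with
  | zero => simpa using hsmul 0 0
  | add u v hu hv =>
    rw [map_add, map_add, map_add, ← hu, ← hv, prod_negSucc, prod_negSucc, prod_negSucc,
      rescale_add, mulField_add_right (hmem u) (hmem v), smul_add]
  | single x c =>
    obtain ⟨S, N, e⟩ := x
    rw [← mul_one c, ← smul_eq_mul, ← Finsupp.smul_single, hsmul, map_smul, map_smul]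
    congr 1
    rw [step_single, map_smul, map_qDiff_pow, prod_negSucc, realize_single, one_smul,
      rescale_pointProduct, iterate_qDeriv_frenkelJing]
    have hqc : ∀ k, QuasiCommutative [xShift k (-n)] (pointProduct (S.map (· + n)) (N + n) e) :=
      fun k => quasiCommutative_xShift k (-n) _ _ e
    have hqc' := quasiCommutative_qDiff_pow qPar n hqc 0
    rw [mulField_smul_right (hqc'.smul_left _), mulField_smul_left hqc',
      mulField_qDiff_pow qPar n hqc, smul_smul, smul_smul, stepScalar]
    have hpt : (fun k => mulField (xShift k (-n)) (pointProduct (S.map (· + n)) (N + n) e)) =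
        fun k => realize (Finsupp.single (k :: S.map (· + n), N + n, e - n) 1) := by
      funext k
      rw [mulField_xShift, realize_single, one_smul, neg_add_eq_sub]
    rw [hpt]
    congr 1
    ring

/-! ### Quadratic relations -/

theorem eval_contraction_eq_zero {k : ℕ} {S : List ℕ} {N : ℕ}
    (h : k = N ∨ ∃ i ∈ S, i = k ∨ i = k + 1) : (contraction k S N).eval 1 = 0 := by
  induction S with
  | nil =>
    obtain rfl : k = N := by simpa using h
    simp [contraction]
  | cons s S ih =>
    rw [contraction, Polynomial.eval_mul, Polynomial.eval_mul]
    by_cases h1 : s = k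
    · subst h1; simp
    by_cases h2 : s = k + 1
    · subst h2; simp
    · rw [ih, mul_zero]
      rcases h with h | ⟨i, hi, h⟩
      · exact Or.inl h
      · rcases List.mem_cons.mp hi with rfl | hi
        · omega
        · exact Or.inr ⟨i, hi, h⟩

theorem pointProduct_eq_zero_of_productScalar {S : List ℕ} {N : ℕ}
    (h : ∀ j, productScalar S N j = 0) (e : ℤ) : pointProduct S N e = 0 := by
  rw [pointProduct, show productScalar S N = fun _ => 0 from funext h, vertexOp_zero]

theorem pointProduct_cons_eq_zero {k : ℕ} {S : List ℕ} {N : ℕ}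
    (h : k = N ∨ ∃ i ∈ S, i = k ∨ i = k + 1) (e : ℤ) : pointProduct (k :: S) N e = 0 :=
  pointProduct_eq_zero_of_productScalar
    (fun j => by simp only [productScalar, eval_contraction_eq_zero h, mul_zero]) e

/-- Two successive products with `x(z)` are the mixed differences of the values of
`x(z p ^ k) x(z p ^ {k'}) w(z p ^ m)`. -/
theorem realize_step_step (n n' : ℕ) (S : List ℕ) (N : ℕ) (e : ℤ) :
    realize (step n (step n' (Finsupp.single (S, N, e) 1))) =
      ((qPar - 1)⁻¹ ^ (n + n') * qPar ^ (((n + n' : ℕ) : ℤ) * e) *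
        (qFact qPar n * qFact qPar n')⁻¹) •
      mixedDiff qPar (fun k k' => pointProduct (k :: k' :: S.map (· + (n + n'))) (N + (n + n'))
        (e - (n + n' : ℕ))) n n' 0 n := by
  have hp := qPar_ne_zero
  set Φ : ℕ → ℕ → LaurentHom QField (FockSpace 0) (FockSpace 1) := fun k k' =>
    pointProduct (k :: k' :: S.map (· + (n + n'))) (N + (n + n')) (e - (n + n' : ℕ)) with hΦ
  have h1 : ∀ k', realize (step n (Finsupp.single (k' :: S.map (· + n'), N + n', e - n') 1)) =
      (stepScalar n * qPar ^ (n * (e - n'))) • (qDiff qPar _ ^ n) Φ 0 (k' + n) := by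
    intro k'
    rw [step_single, map_smul, map_qDiff_pow]
    congr 1
    have h := map_qDiff_pow qPar (LinearMap.proj (R := QField)
      (φ := fun _ : ℕ => LaurentHom QField (FockSpace 0) (FockSpace 1)) (k' + n)) n Φ 0
    refine Eq.trans ?_ h.symm
    refine congrFun (congrArg _ (funext fun k => ?_)) 0
    rw [realize_single, one_smul]
    simp only [LinearMap.proj_apply, hΦ, List.map_cons, List.map_map]
    have e1 : ((fun x => x + n) ∘ fun x => x + n') = fun x : ℕ => x + (n + n') := by
      funext x; simp only [Function.comp_apply]; omega
    rw [e1, show N + n' + n = N + (n + n') by omega,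
      show e - n' - n = e - (n + n' : ℕ) by push_cast; ring]
  rw [step_single, map_smul, map_smul, map_qDiff_pow qPar (step n),
    map_qDiff_pow qPar realize]
  simp_rw [h1]
  have h2 := map_qDiff_pow qPar ((stepScalar n * qPar ^ ((n : ℤ) * (e - n'))) •
    (LinearMap.id : LaurentHom QField (FockSpace 0) (FockSpace 1) →ₗ[QField] _)) n'
      (fun k' => (qDiff qPar _ ^ n) Φ 0 (k' + n)) 0
  simp only [LinearMap.smul_apply, LinearMap.id_apply] at h2
  have h3 : (qDiff qPar _ ^ n') ((qDiff qPar _ ^ n) Φ 0) = mixedDiff qPar Φ n n' 0 :=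
    map_qDiff_pow qPar (qDiff qPar _ ^ n') n Φ 0
  rw [← h2, qDiff_pow_shift hp, zero_add, h3, smul_smul, smul_smul]
  congr 1
  rw [stepScalar, stepScalar, pow_add, mul_inv, mul_sub, zpow_sub₀ hp, Nat.cast_add, add_mul,
    zpow_add₀ hp, ← Nat.cast_mul, zpow_natCast]
  have := pow_ne_zero (n * n') hp
  field_simp

theorem realize_eq_zero_of_single {T : PointSum →ₗ[QField] PointSum}
    (h : ∀ S N e, realize (T (Finsupp.single (S, N, e) 1)) = 0) (w : PointSum) :
    realize (T w) = 0 := by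
  have : realize.comp T = 0 := by
    refine Finsupp.lhom_ext fun x c => ?_
    rw [← mul_one c, ← smul_eq_mul, ← Finsupp.smul_single, map_smul, LinearMap.comp_apply, h,
      smul_zero, LinearMap.zero_apply]
  exact LinearMap.congr_fun this w

theorem qNum_qPar_succ_ne_zero (n : ℕ) : qNum qPar ((n + 1 : ℕ) : ℤ) ≠ 0 :=
  qNum_ne_zero (by omega)

/-- The relation that follows from `x(z) x(z) = 0`. -/
theorem sum_realize_step_step (m : ℕ) (w : PointSum) :
    ∑ x ∈ Finset.HasAntidiagonal.antidiagonal m, realize (step x.1 (step x.2 w)) = 0 := by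
  rw [← map_sum]
  have h := realize_eq_zero_of_single (T := ∑ x ∈ Finset.HasAntidiagonal.antidiagonal m,
    step x.1 ∘ₗ step x.2) (fun S N e => ?_) w
  · rwa [LinearMap.sum_apply] at h
  rw [LinearMap.sum_apply, map_sum]
  set Φ : ℕ → ℕ → LaurentHom QField (FockSpace 0) (FockSpace 1) := fun k k' =>
    pointProduct (k :: k' :: S.map (· + m)) (N + m) (e - m) with hΦ
  have hdiag : (fun a => Φ a a) = 0 := funext fun a =>
    pointProduct_cons_eq_zero (Or.inr ⟨a, List.mem_cons_self, Or.inl rfl⟩) _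
  have hL := qDiff_pow_diagonal qPar_ne_zero qNum_qPar_succ_ne_zero Φ m 0
  rw [hdiag, map_zero, Pi.zero_apply, eq_comm, smul_eq_zero, or_iff_right (qFact_ne_zero m)] at hL
  refine Eq.trans ?_ ((congrArg (((qPar - 1)⁻¹ ^ m * qPar ^ ((m : ℤ) * e)) • ·) hL).trans
    (smul_zero _))
  rw [Finset.smul_sum]
  refine Finset.sum_congr rfl fun x hx => ?_
  rw [LinearMap.comp_apply, realize_step_step, smul_smul, zero_add,
    Finset.HasAntidiagonal.mem_antidiagonal.mp hx]

/-- The relation that follows from `x(z) x(z p) = 0`. -/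
theorem sum_qNum_smul_realize_step_step (m : ℕ) (w : PointSum) :
    ∑ x ∈ Finset.HasAntidiagonal.antidiagonal m,
      qNum qPar ((x.2 + 1 : ℕ) : ℤ) • realize (step x.1 (step (x.2 + 1) w)) = 0 := by
  have h := realize_eq_zero_of_single (T := ∑ x ∈ Finset.HasAntidiagonal.antidiagonal m,
    qNum qPar ((x.2 + 1 : ℕ) : ℤ) • (step x.1 ∘ₗ step (x.2 + 1))) (fun S N e => ?_) w
  · rw [LinearMap.sum_apply, map_sum] at h
    simpa only [LinearMap.smul_apply, map_smul, LinearMap.comp_apply] using h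
  rw [LinearMap.sum_apply, map_sum]
  set Φ : ℕ → ℕ → LaurentHom QField (FockSpace 0) (FockSpace 1) := fun k k' =>
    pointProduct (k :: k' :: S.map (· + (m + 1))) (N + (m + 1)) (e - (m + 1 : ℕ)) with hΦ
  have hdiag : (fun a => qDiff qPar _ (Φ a) a) = 0 := funext fun a => by
    have h1 : Φ a a = 0 :=
      pointProduct_cons_eq_zero (Or.inr ⟨a, List.mem_cons_self, Or.inl rfl⟩) _
    have h2 : Φ a (a + 1) = 0 :=
      pointProduct_cons_eq_zero (Or.inr ⟨a + 1, List.mem_cons_self, Or.inr rfl⟩) _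
    rw [qDiff_apply, h1, h2, sub_zero, smul_zero, Pi.zero_apply]
  have hL := qDiff_pow_diagonal qPar_ne_zero qNum_qPar_succ_ne_zero
    (fun k => qDiff qPar _ (Φ k)) m 0
  rw [hdiag, map_zero, Pi.zero_apply, eq_comm, smul_eq_zero, or_iff_right (qFact_ne_zero m)] at hL
  refine Eq.trans ?_ ((congrArg
    (((qPar - 1)⁻¹ ^ (m + 1) * qPar ^ (((m + 1 : ℕ) : ℤ) * e)) • ·) hL).trans (smul_zero _))
  rw [Finset.smul_sum]
  refine Finset.sum_congr rfl fun x hx => ?_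
  have hx' := Finset.HasAntidiagonal.mem_antidiagonal.mp hx
  rw [LinearMap.smul_apply, map_smul, LinearMap.comp_apply, realize_step_step, smul_smul, smul_smul,
    zero_add, mixedDiff_qDiff, show x.1 + (x.2 + 1) = m + 1 by omega, qFact_succ]
  congr 1
  have h1 := qFact_ne_zero x.1
  have h2 := qFact_ne_zero x.2
  have h3 := qNum_qPar_succ_ne_zero x.2
  field_simp

/-! ### Separated configurations -/

/-- The configurations `s_m < ⋯ < s_1 < N` in which the `s_j` have gaps at least `2`. -/
def Separated : List ℕ → ℕ → Prop
  | [], _ => True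
  | s :: S, N => s + 2 ≤ S.headD (N + 1) ∧ Separated S N

/-- The configurations `s_m ≤ ⋯ ≤ s_1 ≤ N`. -/
def WeaklyOrdered : List ℕ → ℕ → Prop
  | [], _ => True
  | s :: S, N => s ≤ S.headD N ∧ WeaklyOrdered S N

theorem Separated.headD_le {S : List ℕ} {N : ℕ} (h : Separated S N) : S.headD (N + 1) ≤ N + 1 := by
  induction S with
  | nil => exact le_rfl
  | cons s S ih =>
    have h1 := h.1
    have h2 := ih h.2
    rw [List.headD_cons]
    omega

theorem Separated.headD_le_of_mem {S : List ℕ} {N : ℕ} (h : Separated S N) {i : ℕ} (hi : i ∈ S) :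
    S.headD (N + 1) ≤ i := by
  induction S with
  | nil => simp at hi
  | cons s S ih =>
    rw [List.headD_cons]
    rcases List.mem_cons.mp hi with rfl | hi
    · exact le_rfl
    · have h1 := h.1
      have h2 := ih h.2 hi
      omega

theorem eval_contraction_ne_zero {k : ℕ} {S : List ℕ} {N : ℕ} (hN : k < N)
    (h : ∀ i ∈ S, k + 2 ≤ i) : (contraction k S N).eval 1 ≠ 0 := by
  have hf : ∀ j : ℤ, j ≠ 0 → (1 - Polynomial.C (qPar ^ j) * Polynomial.X).eval 1 ≠ 0 := by
    intro j hj h0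
    simp only [Polynomial.eval_sub, Polynomial.eval_one, Polynomial.eval_mul, Polynomial.eval_C,
      Polynomial.eval_X, mul_one] at h0
    exact hj (qPar_zpow_eq_one (sub_eq_zero.mp h0).symm)
  induction S with
  | nil => exact hf _ (by omega)
  | cons s S ih =>
    have hs := h s List.mem_cons_self
    rw [contraction, Polynomial.eval_mul, Polynomial.eval_mul]
    exact mul_ne_zero (mul_ne_zero (hf _ (by omega)) (hf _ (by omega)))
      (ih fun i hi => h i (List.mem_cons_of_mem _ hi))

theorem Separated.productScalar_ne_zero {S : List ℕ} {N : ℕ} (h : Separated S N) (j : ℤ) :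
    productScalar S N j ≠ 0 := by
  have hp := qPar_ne_zero
  induction S with
  | nil => exact mul_ne_zero (zpow_ne_zero _ hp) (zpow_ne_zero _ (by norm_num))
  | cons s S ih =>
    have h1 := h.1
    have h2 := h.2.headD_le
    refine mul_ne_zero (mul_ne_zero (ih h.2) (zpow_ne_zero _ hp))
      (eval_contraction_ne_zero (by omega) fun i hi => ?_)
    have := h.2.headD_le_of_mem hi
    omega

/-- A weakly ordered product vanishes unless it is separated, because of the zeros of
`x(z) x(w)` at `w = z`, `w = z p` and of `x(z) 𝒴(w)` at `w = z`. -/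
theorem WeaklyOrdered.separated_or_productScalar {S : List ℕ} {N : ℕ} (h : WeaklyOrdered S N) :
    Separated S N ∨ ∀ j, productScalar S N j = 0 := by
  induction S with
  | nil => exact Or.inl trivial
  | cons s S ih =>
    rcases ih h.2 with h2 | h2
    · by_cases hs : s + 2 ≤ S.headD (N + 1)
      · exact Or.inl ⟨hs, h2⟩
      · refine Or.inr fun j => ?_
        have h1 := h.1
        have hz : (contraction s S N).eval 1 = 0 := by
          refine eval_contraction_eq_zero ?_
          cases S with
          | nil =>
            simp only [List.headD_nil] at h1 hs
            exact Or.inl (by omega)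
          | cons i S =>
            simp only [List.headD_cons] at h1 hs
            exact Or.inr ⟨i, List.mem_cons_self, by omega⟩
        simp only [productScalar, hz, mul_zero]
    · exact Or.inr fun j => by simp only [productScalar, h2, zero_mul]

/-! ### Independence of the products at separated points -/

/-- The sequence of the coefficients of `A(z) (1 ⊗ e^0)`. -/
def vacuumModes : LaurentHom QField (FockSpace 0) (FockSpace 1) →ₗ[QField] (ℤ → FockSpace 1) where
  toFun A n := mode A n (Finsupp.single 0 1)
  map_add' _ _ := rfl
  map_smul' _ _ := rfl

/-- The operator `a(1)`, applied to all coefficients of a Laurent series and followed by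
multiplication by `z ^ (-1)`; the vectors `exp (∑ c_r a(-r) z ^ r) 1` are eigenvectors. -/
def lowering : Module.End QField (ℤ → FockSpace 1) where
  toFun g n := Finsupp.mapRange.linearMap (heisPos 1) (g (n + 1))
  map_add' g h := by funext n; simp only [Pi.add_apply, map_add]
  map_smul' c g := by funext n; simp only [Pi.smul_apply, map_smul, RingHom.id_apply]

theorem heisPos_one_expNeg (c : ℕ+ → QField) (n : ℤ) :
    heisPos 1 (expNeg c (n + 1) 1) = (heisScalar 1 * c 1) • expNeg c n 1 := by
  have h1 : heisPos 1 1 = 0 := by simp [heisPos]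
  rcases lt_or_ge n 0 with hn | hn
  · rw [expNeg_of_neg c hn, LinearMap.zero_apply, smul_zero]
    rcases lt_or_ge (n + 1) 0 with hn' | hn'
    · rw [expNeg_of_neg c hn', LinearMap.zero_apply, map_zero]
    · rw [show n + 1 = ((0 : ℕ) : ℤ) by push_cast; omega, expNeg_natCast, coeff_zero_expSeries,
        Module.End.one_apply, h1]
  · lift n to ℕ using hn
    have h := congrArg (PowerSeries.coeff (n + 1)) (C_heisPos_mul_expSeries c 1)
    rw [PowerSeries.coeff_C_mul, map_add, PowerSeries.coeff_mul_C, PowerSeries.coeff_smul,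
      PNat.one_coe, pow_one, PowerSeries.coeff_succ_X_mul] at h
    have h' := LinearMap.congr_fun h 1
    rw [LinearMap.add_apply, Module.End.mul_apply, Module.End.mul_apply, h1, map_zero, zero_add,
      LinearMap.smul_apply] at h'
    rw [← Nat.cast_succ, expNeg_natCast, expNeg_natCast]
    exact h'

theorem expMode_one (c d : ℕ+ → QField) (n : ℤ) : expMode c d n 1 = expNeg c n 1 := by
  have h1 : (1 : Heis) ∈ weightLE 0 := Submodule.subset_span ⟨0, by simp, rfl⟩
  rw [expMode_apply c d n (J := 1)]
  · rw [Finset.sum_range_one, expPos, coeff_zero_expSeries, Module.End.one_apply, Nat.cast_zero,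
      add_zero]
  · intro j hj
    rw [expPos, expSeries, PowerSeries.coeff_mk, LinearMap.sum_apply]
    refine Finset.sum_eq_zero fun k _ => ?_
    rw [LinearMap.smul_apply, weightLE_neg (by omega) (coeff_pow_opSeries_mem d k j h1), smul_zero]

theorem vacuumModes_pointProduct (S : List ℕ) (N : ℕ) (e n : ℤ) :
    vacuumModes (pointProduct S N e) n = Finsupp.single (S.length : ℤ)
      (productScalar S N 0 • expNeg (creationCoeff S N) (n - (productExponent S 0 + e)) 1) := by
  change mode (pointProduct S N e) n (Finsupp.single 0 1) = _
  rw [pointProduct, mode_vertexOp, expMode_one, zero_add, Finsupp.smul_single]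

theorem lowering_vacuumModes (S : List ℕ) (N : ℕ) (e : ℤ) :
    lowering (vacuumModes (pointProduct S N e)) =
      (heisScalar 1 * creationCoeff S N 1) • vacuumModes (pointProduct S N e) := by
  funext n
  change Finsupp.mapRange.linearMap (heisPos 1) (vacuumModes (pointProduct S N e) (n + 1)) =
    (heisScalar 1 * creationCoeff S N 1) • vacuumModes (pointProduct S N e) n
  rw [vacuumModes_pointProduct, vacuumModes_pointProduct, Finsupp.mapRange.linearMap_apply,
    Finsupp.mapRange_single, map_smul, add_sub_right_comm, heisPos_one_expNeg,
    Finsupp.smul_single, smul_comm]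

theorem vacuumModes_pointProduct_ne_zero {S : List ℕ} {N : ℕ} (h : Separated S N) (e : ℤ) :
    vacuumModes (pointProduct S N e) ≠ 0 := by
  intro h0
  have h1 := congrFun h0 (productExponent S 0 + e)
  rw [vacuumModes_pointProduct, sub_self, Pi.zero_apply, Finsupp.single_eq_zero, smul_eq_zero,
    or_iff_right (h.productScalar_ne_zero 0), ← Nat.cast_zero, expNeg_natCast,
    coeff_zero_expSeries, Module.End.one_apply] at h1
  exact one_ne_zero h1

/-- The polynomial `∑_j (y ^ {s_j} + y ^ {s_j + 1}) + y ^ {N + 1}`, which is the eigenvalue of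
`lowering` at `y = p`, up to normalization. -/
def configPoly : List ℕ → ℕ → Polynomial ℂ
  | [], N => Polynomial.X ^ (N + 1)
  | s :: S, N => Polynomial.X ^ s + Polynomial.X ^ (s + 1) + configPoly S N

theorem eigenvalue_eq (S : List ℕ) (N : ℕ) :
    qHalf ^ 3 * (heisScalar 1 * creationCoeff S N 1) =
      algebraMap (Polynomial ℂ) QField (Polynomial.expand ℂ 4 (configPoly S N)) := by
  have hH := qHalf_ne_zero
  have h1 : qInt 1 = 1 := by
    have := qq_pow_sub_inv_ne_zero one_ne_zero
    rw [pow_one] at this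
    rw [qInt, pow_one, div_self this]
  have h2 : qInt (2 * 1) ≠ 0 := qInt_ne_zero (by norm_num)
  have hX : ∀ n : ℕ, algebraMap (Polynomial ℂ) QField (Polynomial.X ^ (4 * n)) = qPar ^ n := by
    intro n
    rw [map_pow, RatFunc.algebraMap_X, qPar_pow, qHalf]
  have hp : qPar = qHalf ^ 4 := by simpa using qPar_pow 1
  have he : ∀ n : ℕ, Polynomial.expand ℂ 4 (Polynomial.X ^ n) = Polynomial.X ^ (4 * n) := by
    intro n
    rw [map_pow, Polynomial.expand_X, pow_mul]
  induction S with
  | nil =>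
    have hy : qHalf ^ 3 * (heisScalar 1 * ((qPar ^ N) ^ ((1 : ℕ+) : ℕ) * yCoeff 1)) =
        qPar ^ (N + 1) := by
      simp only [heisScalar, yCoeff, PNat.one_coe, pow_one, Nat.cast_one, div_one, pow_succ qPar,
        h1, mul_one]
      rw [hp]
      field_simp
    rw [creationCoeff, configPoly, hy, he, hX]
  | cons s S ih =>
    have hx : qHalf ^ 3 * (heisScalar 1 * ((qPar ^ s) ^ ((1 : ℕ+) : ℕ) * xCoeff 1)) =
        qPar ^ s + qPar ^ (s + 1) := by
      simp only [heisScalar, xCoeff, PNat.one_coe, pow_one, Nat.cast_one, div_one, pow_succ qPar]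
      rw [qInt_two_mul, pow_one, h1, qq, hp]
      field_simp
      ring
    rw [creationCoeff, configPoly, Pi.add_apply, mul_add, mul_add, ih, hx, map_add, map_add,
      map_add, map_add, he, he, hX, hX]

theorem Separated.coeff_configPoly_of_lt {S : List ℕ} {N : ℕ} (h : Separated S N) {n : ℕ}
    (hn : n < S.headD (N + 1)) : (configPoly S N).coeff n = 0 := by
  induction S with
  | nil =>
    rw [List.headD_nil] at hn
    rw [configPoly, Polynomial.coeff_X_pow, if_neg (by omega)]
  | cons s S ih =>
    rw [List.headD_cons] at hn
    have h1 := h.1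
    rw [configPoly, Polynomial.coeff_add, Polynomial.coeff_add, Polynomial.coeff_X_pow,
      Polynomial.coeff_X_pow, if_neg (by omega), if_neg (by omega), ih h.2 (by omega), add_zero,
      add_zero]

theorem Separated.coeff_configPoly_headD {S : List ℕ} {N : ℕ} (h : Separated S N) :
    (configPoly S N).coeff (S.headD (N + 1)) = 1 := by
  cases S with
  | nil => rw [List.headD_nil, configPoly, Polynomial.coeff_X_pow, if_pos rfl]
  | cons s S =>
    have h1 := h.1
    rw [List.headD_cons, configPoly, Polynomial.coeff_add, Polynomial.coeff_add,
      Polynomial.coeff_X_pow, Polynomial.coeff_X_pow, if_pos rfl, if_neg (by omega),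
      h.2.coeff_configPoly_of_lt (by omega), add_zero, add_zero]

/-- A separated configuration is determined by the exponents `s_j`, `s_j + 1` and `N + 1`, which are
pairwise different. -/
theorem Separated.configPoly_injective {S S' : List ℕ} {N N' : ℕ} (h : Separated S N)
    (h' : Separated S' N') (heq : configPoly S N = configPoly S' N') : S = S' ∧ N = N' := by
  have hhead : ∀ {S S' : List ℕ} {N N' : ℕ}, Separated S N → Separated S' N' →
      configPoly S N = configPoly S' N' → S'.headD (N' + 1) ≤ S.headD (N + 1) := by
    intro S S' N N' h h' heq
    by_contra hc
    have h1 := h.coeff_configPoly_headD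
    rw [heq, h'.coeff_configPoly_of_lt (not_le.mp hc)] at h1
    exact zero_ne_one h1
  -- The coefficient of `y ^ (s + 1)` distinguishes `y ^ (N + 1)` from a configuration with an `s`.
  have hnil : ∀ {s : ℕ} {S : List ℕ} {N N' : ℕ}, Separated (s :: S) N →
      configPoly (s :: S) N ≠ configPoly [] N' := by
    intro s S N N' h heq
    have h1 := hhead (S' := []) h trivial heq
    have h2 := hhead (S := []) trivial h heq.symm
    rw [List.headD_nil, List.headD_cons] at h1 h2
    have h3 := h.1
    have h4 := congrArg (fun f => Polynomial.coeff f (s + 1)) heq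
    simp only [configPoly, Polynomial.coeff_add, Polynomial.coeff_X_pow] at h4
    rw [if_neg (by omega), if_neg (show ¬ s + 1 = N' + 1 by omega),
      h.2.coeff_configPoly_of_lt (by omega)] at h4
    simp at h4
  induction S generalizing S' with
  | nil =>
    cases S' with
    | nil =>
      have h1 := hhead h h' heq
      have h2 := hhead h' h heq.symm
      rw [List.headD_nil, List.headD_nil] at h1 h2
      exact ⟨rfl, by omega⟩
    | cons s' S' => exact absurd heq.symm (hnil h')
  | cons s S ih =>
    cases S' with
    | nil => exact absurd heq (hnil h)
    | cons s' S' =>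
      have h1 := hhead h h' heq
      have h2 := hhead h' h heq.symm
      rw [List.headD_cons, List.headD_cons] at h1 h2
      obtain rfl : s = s' := le_antisymm h2 h1
      obtain ⟨rfl, rfl⟩ := ih h.2 h'.2 (add_left_cancel heq)
      exact ⟨rfl, rfl⟩

/-- The separated configurations. -/
abbrev Config : Type := {x : List ℕ × ℕ // Separated x.1 x.2}

/-- `z ^ (-N) x(z p ^ {s_m}) ⋯ x(z p ^ {s_1}) 𝒴(z p ^ N)`. -/
def configProduct (x : Config) : LaurentHom QField (FockSpace 0) (FockSpace 1) :=
  pointProduct x.1.1 x.1.2 (-x.1.2)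

theorem linearIndependent_configProduct : LinearIndependent QField configProduct := by
  refine LinearIndependent.of_comp vacuumModes ?_
  refine Module.End.eigenvectors_linearIndependent' lowering
    (fun x : Config => heisScalar 1 * creationCoeff x.1.1 x.1.2 1) ?_ _ ?_
  · rintro ⟨⟨S, N⟩, h⟩ ⟨⟨S', N'⟩, h'⟩ heq
    have h1 := congrArg (qHalf ^ 3 * ·) heq
    simp only [eigenvalue_eq] at h1
    have h2 := Polynomial.expand_injective (by norm_num) (RatFunc.algebraMap_injective ℂ h1)
    obtain ⟨rfl, rfl⟩ := h.configPoly_injective h' h2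
    rfl
  · intro x
    exact ⟨Module.End.mem_eigenspace_iff.mpr (lowering_vacuumModes _ _ _),
      vacuumModes_pointProduct_ne_zero x.2 _⟩

/-! ### Triangularity -/

/-- A family is linearly independent if it is triangular with respect to a linearly independent
family, with different leading terms. -/
theorem linearIndependent_of_leading {F V ι κ : Type*} [Field F] [AddCommGroup V] [Module F V]
    {b : κ → V} (hb : LinearIndependent F b) {v : ι → V} {lead : ι → κ}
    (hlead : Function.Injective lead) (wt : κ → ℕ)
    (h : ∀ i, ∃ c : F, c ≠ 0 ∧
      v i - c • b (lead i) ∈ Submodule.span F (b '' {k | wt (lead i) < wt k})) :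
    LinearIndependent F v := by
  classical
  rw [linearIndependent_iff']
  intro s g hg
  by_contra! hne
  obtain ⟨i₁, hi₁, hgi₁⟩ := hne
  -- In a vanishing linear combination, a leading term of minimal weight cannot cancel.
  obtain ⟨i₀, hi₀, hmin⟩ := (s.filter (g · ≠ 0)).exists_min_image (fun i => wt (lead i))
    ⟨i₁, Finset.mem_filter.mpr ⟨hi₁, hgi₁⟩⟩
  rw [Finset.mem_filter] at hi₀
  set U := Submodule.span F (b '' {k | k ≠ lead i₀}) with hU
  have htail : ∀ {i} {x : V}, wt (lead i₀) ≤ wt (lead i) →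
      x ∈ Submodule.span F (b '' {k | wt (lead i) < wt k}) → x ∈ U := by
    intro i x hi hx
    refine Submodule.span_mono (Set.image_mono ?_) hx
    rintro k hk rfl
    exact absurd hk (not_lt.mpr hi)
  have hother : ∀ i ∈ s.erase i₀, g i • v i ∈ U := by
    intro i hi
    rw [Finset.mem_erase] at hi
    by_cases hgi : g i = 0
    · rw [hgi, zero_smul]; exact zero_mem _
    obtain ⟨c, -, hc⟩ := h i
    refine Submodule.smul_mem _ _ ?_
    rw [← sub_add_cancel (v i) (c • b (lead i))]
    exact add_mem (htail (hmin i (Finset.mem_filter.mpr ⟨hi.2, hgi⟩)) hc) (Submodule.smul_mem _ _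
      (Submodule.subset_span ⟨lead i, fun h => hi.1 (hlead h), rfl⟩))
  obtain ⟨c, hc0, hc⟩ := h i₀
  have hv : g i₀ • v i₀ ∈ U := by
    rw [← Finset.add_sum_erase s _ hi₀.1] at hg
    rw [eq_neg_of_add_eq_zero_left hg]
    exact neg_mem (sum_mem hother)
  have hb' : b (lead i₀) ∈ U := by
    have h1 : v i₀ ∈ U := (Submodule.smul_mem_iff _ hi₀.2).mp hv
    have h2 := sub_mem h1 (htail le_rfl hc)
    rw [sub_sub_cancel] at h2
    exact (Submodule.smul_mem_iff _ hc0).mp h2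
  exact hb.notMem_span_image (s := {k | k ≠ lead i₀}) (fun h => h rfl) hb'

/-- `x(z)_{-n_m-1} ⋯ x(z)_{-n_1-1} 𝒴(z)` as a formal linear combination, for the list
`[n_m, …, n_1]`. -/
def formalMonomial : List ℕ → PointSum
  | [] => Finsupp.single ([], 0, 0) 1
  | n :: ns => step n (formalMonomial ns)

theorem koyamaMonomial_map_negSucc (ns : List ℕ) :
    koyamaMonomial (ns.map Int.negSucc) = realize (formalMonomial ns) := by
  induction ns with
  | nil => rw [List.map_nil, koyamaMonomial, formalMonomial, realize_single, one_smul, koyama_eq]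
  | cons n ns ih =>
    rw [List.map_cons, koyamaMonomial, ih, prod_frenkelJing_realize, formalMonomial]

/-- The leading configuration of the monomial with the exponents `[n_m, …, n_1]`: with
`N_j = n_m + ⋯ + n_j` it is `s_m = 0`, `s_j = N_{j+1}` for `j < m`, and `N = N_1`. -/
def leadConfig : List ℕ → List ℕ × ℕ
  | [] => ([], 0)
  | n :: ns => (0 :: (leadConfig ns).1.map (· + n), (leadConfig ns).2 + n)

theorem length_leadConfig (ns : List ℕ) : (leadConfig ns).1.length = ns.length := by
  induction ns with
  | nil => rfl
  | cons n ns ih => rw [leadConfig, List.length_cons, List.length_map, ih, List.length_cons]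

theorem leadConfig_injective : Function.Injective leadConfig := by
  intro ns
  induction ns with
  | nil =>
    intro ns' h
    cases ns' with
    | nil => rfl
    | cons n' ns' => simp [leadConfig] at h
  | cons n ns ih =>
    intro ns' h
    cases ns' with
    | nil => simp [leadConfig] at h
    | cons n' ns' =>
      simp only [leadConfig, Prod.mk.injEq, List.cons.injEq, true_and] at h
      obtain ⟨h1, h2⟩ := h
      have hlen := congrArg List.length h1
      rw [List.length_map, List.length_map, length_leadConfig, length_leadConfig] at hlen
      obtain rfl : n = n' := by
        cases ns with
        | nil =>
          obtain rfl : ns' = [] := List.length_eq_zero_iff.mp hlen.symm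
          simpa [leadConfig] using h2
        | cons a as =>
          cases ns' with
          | nil => simp at hlen
          | cons a' as' =>
            simp only [leadConfig, List.map_cons, List.cons.injEq, zero_add] at h1
            exact h1.1
      have h3 : (leadConfig ns).1 = (leadConfig ns').1 :=
        List.map_injective_iff.mpr (add_left_injective n) h1
      rw [ih (Prod.ext h3 (by omega))]

theorem headD_map_add (S : List ℕ) (N n : ℕ) :
    (S.map (· + n)).headD (N + n) = S.headD N + n := by
  cases S <;> rfl

theorem WeaklyOrdered.map_add {S : List ℕ} {N : ℕ} (h : WeaklyOrdered S N) (n : ℕ) :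
    WeaklyOrdered (S.map (· + n)) (N + n) := by
  induction S with
  | nil => trivial
  | cons s S ih =>
    refine ⟨?_, ih h.2⟩
    rw [headD_map_add]
    exact Nat.add_le_add_right h.1 n

theorem Separated.map_add {S : List ℕ} {N : ℕ} (h : Separated S N) (n : ℕ) :
    Separated (S.map (· + n)) (N + n) := by
  induction S with
  | nil => trivial
  | cons s S ih =>
    refine ⟨?_, ih h.2⟩
    rw [show N + n + 1 = N + 1 + n by omega, headD_map_add]
    have := h.1
    change s + n + 2 ≤ _
    omega

theorem separated_leadConfig {ns : List ℕ} (h : BasisIndex (ns.map Int.negSucc)) :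
    Separated (leadConfig ns).1 (leadConfig ns).2 := by
  induction ns with
  | nil => trivial
  | cons n ns ih =>
    cases ns with
    | nil =>
      have h1 : Int.negSucc n ≤ -2 := h
      simp only [leadConfig, List.map_nil]
      exact ⟨by simp only [List.headD_nil]; omega, trivial⟩
    | cons n' ns =>
      have h1 : Int.negSucc n ≤ -3 := h.1
      refine ⟨?_, (ih h.2).map_add n⟩
      simp only [leadConfig, List.map_cons, List.headD_cons]
      omega

/-- The basis vectors of the formal linear combinations that are allowed in the tail of a monomial
with leading configuration `x`. -/
def tailTerms (x : List ℕ × ℕ) : Set PointSum :=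
  {u | ∃ S : List ℕ, WeaklyOrdered S x.2 ∧ S.length = x.1.length ∧ x.1.sum < S.sum ∧
    u = Finsupp.single (S, x.2, -(x.2 : ℤ)) 1}

theorem sum_map_add (S : List ℕ) (n : ℕ) : (S.map (· + n)).sum = S.sum + S.length * n := by
  induction S with
  | nil => simp
  | cons s S ih =>
    rw [List.map_cons, List.sum_cons, ih, List.sum_cons, List.length_cons]
    ring

theorem weaklyOrdered_leadConfig (ns : List ℕ) :
    WeaklyOrdered (leadConfig ns).1 (leadConfig ns).2 := by
  induction ns with
  | nil => trivial
  | cons n ns ih => exact ⟨Nat.zero_le _, ih.map_add n⟩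

/-- A monomial is a nonzero multiple of its leading term, up to weakly ordered configurations with a
larger sum of the `s_j`. -/
theorem exists_formalMonomial_sub_mem (ns : List ℕ) : ∃ c : QField, c ≠ 0 ∧
    formalMonomial ns - c • Finsupp.single ((leadConfig ns).1, (leadConfig ns).2,
      -((leadConfig ns).2 : ℤ)) 1 ∈ Submodule.span QField (tailTerms (leadConfig ns)) := by
  have hp := qPar_ne_zero
  induction ns with
  | nil => exact ⟨1, one_ne_zero, by simp [formalMonomial, leadConfig]⟩
  | cons n ns ih =>
    obtain ⟨c, hc, h⟩ := ih
    set S := (leadConfig ns).1 with hS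
    set N := (leadConfig ns).2 with hN
    have hlead : leadConfig (n :: ns) = (0 :: S.map (· + n), N + n) := rfl
    have hstep : ∀ T : List ℕ, ∃ d : QField, d ≠ 0 ∧
        step n (Finsupp.single (T, N, -(N : ℤ)) 1) -
          d • Finsupp.single (0 :: T.map (· + n), N + n, -((N + n : ℕ) : ℤ)) 1 ∈
          Submodule.span QField ((fun k : ℕ => (Finsupp.single
            (k :: T.map (· + n), N + n, -((N + n : ℕ) : ℤ)) 1 : PointSum)) ''
              {k | 0 < k ∧ k ≤ 0 + n}) := by
      intro T
      obtain ⟨d, hd, h⟩ := exists_qDiff_pow_sub_mem hp (fun k : ℕ => (Finsupp.single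
            (k :: T.map (· + n), N + n, -((N + n : ℕ) : ℤ)) 1 : PointSum)) n 0
      have hs : stepScalar n * qPar ^ (n * -(N : ℤ)) ≠ 0 :=
        mul_ne_zero (mul_ne_zero (inv_ne_zero (qFact_ne_zero n))
          (pow_ne_zero _ (inv_ne_zero qPar_sub_one_ne_zero))) (zpow_ne_zero _ hp)
      refine ⟨stepScalar n * qPar ^ (n * -(N : ℤ)) * d, mul_ne_zero hs hd, ?_⟩
      rw [step_single, mul_smul _ d, show -(N : ℤ) - n = -((N + n : ℕ) : ℤ) by push_cast; ring,
        ← smul_sub]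
      exact Submodule.smul_mem _ _ h
    have htail : ∀ T : List ℕ, WeaklyOrdered T N → T.length = S.length → S.sum ≤ T.sum →
        ∀ k : ℕ, k ≤ n → (S.sum < T.sum ∨ 0 < k) →
        (Finsupp.single (k :: T.map (· + n), N + n, -((N + n : ℕ) : ℤ)) 1 : PointSum) ∈
          Submodule.span QField (tailTerms (leadConfig (n :: ns))) := by
      intro T hT hlen hsum k hk hpos
      refine Submodule.subset_span ⟨k :: T.map (· + n), ⟨?_, hT.map_add n⟩, ?_, ?_, ?_⟩
      · rw [hlead, headD_map_add]; omega
      · rw [hlead]; simp [hlen]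
      · rw [hlead, List.sum_cons, List.sum_cons, sum_map_add, sum_map_add, hlen]
        omega
      · rw [hlead]
    obtain ⟨d, hd, hdm⟩ := hstep S
    refine ⟨c * d, mul_ne_zero hc hd, ?_⟩
    have hsplit : formalMonomial (n :: ns) - (c * d) •
        Finsupp.single (0 :: S.map (· + n), N + n, -((N + n : ℕ) : ℤ)) 1 =
        step n (formalMonomial ns - c • Finsupp.single (S, N, -(N : ℤ)) 1) +
          c • (step n (Finsupp.single (S, N, -(N : ℤ)) 1) -
            d • Finsupp.single (0 :: S.map (· + n), N + n, -((N + n : ℕ) : ℤ)) 1) := by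
      rw [formalMonomial, map_sub, map_smul, smul_sub, smul_smul, sub_add_sub_cancel]
    rw [hlead, hsplit, ← hlead]
    refine add_mem ?_ (Submodule.smul_mem _ _ ?_)
    · have hle : Submodule.span QField (tailTerms (leadConfig ns)) ≤
          (Submodule.span QField (tailTerms (leadConfig (n :: ns)))).comap (step n) := by
        rw [Submodule.span_le]
        rintro _ ⟨T, hT, hlen, hsum, rfl⟩
        obtain ⟨d', -, hd'⟩ := hstep T
        rw [SetLike.mem_coe, Submodule.mem_comap, ← sub_add_cancel (step n _) (d' •
          Finsupp.single (0 :: T.map (· + n), N + n, -((N + n : ℕ) : ℤ)) 1)]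
        refine add_mem (Submodule.span_le.mpr ?_ hd')
          (Submodule.smul_mem _ _ (htail T hT hlen hsum.le 0 (Nat.zero_le n) (Or.inl hsum)))
        rintro _ ⟨k, ⟨hk0, hk⟩, rfl⟩
        exact htail T hT hlen hsum.le k (by omega) (Or.inr hk0)
      exact hle h
    · refine Submodule.span_le.mpr ?_ hdm
      rintro _ ⟨k, ⟨hk0, hk⟩, rfl⟩
      exact htail S (weaklyOrdered_leadConfig ns) rfl le_rfl k (by omega) (Or.inr hk0)

/-- Among the terms of the tail only the separated configurations contribute. -/
theorem realize_tail_mem {x : List ℕ × ℕ} {u : PointSum}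
    (h : u ∈ Submodule.span QField (tailTerms x)) :
    realize u ∈ Submodule.span QField
      (configProduct '' {y : Config | x.1.sum < y.1.1.sum}) := by
  have hle : Submodule.span QField (tailTerms x) ≤ (Submodule.span QField
      (configProduct '' {y : Config | x.1.sum < y.1.1.sum})).comap realize := by
    rw [Submodule.span_le]
    rintro _ ⟨S, hS, -, hsum, rfl⟩
    rw [SetLike.mem_coe, Submodule.mem_comap, realize_single, one_smul]
    rcases hS.separated_or_productScalar with hsep | hz
    · exact Submodule.subset_span ⟨⟨(S, x.2), hsep⟩, hsum, rfl⟩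
    · rw [pointProduct_eq_zero_of_productScalar hz]
      exact zero_mem _
  exact hle h

theorem linearIndependent_formalMonomial :
    LinearIndependent QField
      fun ns : {ns : List ℕ // BasisIndex (ns.map Int.negSucc)} =>
        realize (formalMonomial ns.1) := by
  refine linearIndependent_of_leading linearIndependent_configProduct
    (lead := fun ns => ⟨leadConfig ns.1, separated_leadConfig ns.2⟩) ?_
    (fun x : Config => x.1.1.sum) fun ns => ?_
  · intro ns ns' h
    exact Subtype.ext (leadConfig_injective (congrArg Subtype.val h))
  · obtain ⟨c, hc, h⟩ := exists_formalMonomial_sub_mem ns.1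
    refine ⟨c, hc, ?_⟩
    have h' := realize_tail_mem h
    rwa [map_sub, map_smul, realize_single, one_smul] at h'

/-! ### Spanning -/

theorem basisIndex_singleton {n : ℕ} (h : 1 ≤ n) : BasisIndex ([n].map Int.negSucc) := by
  change Int.negSucc n ≤ -2
  omega

theorem basisIndex_cons {n : ℕ} {ns : List ℕ} (hn : 2 ≤ n)
    (h : BasisIndex (ns.map Int.negSucc)) : BasisIndex ((n :: ns).map Int.negSucc) := by
  cases ns with
  | nil => exact basisIndex_singleton (by omega)
  | cons n' ns => exact ⟨by omega, h⟩

/-- The formal monomials of length `m` with the exponents of the basis. -/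
def basisMonomials (m : ℕ) : Set PointSum :=
  {u | ∃ ns : List ℕ, BasisIndex (ns.map Int.negSucc) ∧ ns.length = m ∧ u = formalMonomial ns}

/-- The span of the basis monomials of length `m`. -/
def basisSpan (m : ℕ) : Submodule QField (LaurentHom QField (FockSpace 0) (FockSpace 1)) :=
  (Submodule.span QField (basisMonomials m)).map realize

theorem realize_formalMonomial_mem {ns : List ℕ} (h : BasisIndex (ns.map Int.negSucc)) :
    realize (formalMonomial ns) ∈ basisSpan ns.length :=
  Submodule.mem_map_of_mem (Submodule.subset_span ⟨ns, h, rfl, rfl⟩)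

/-- The product with `x(z)` depends only on the operator that a formal linear combination
represents, so it may be computed on basis monomials. -/
theorem realize_step_mem {m m' n : ℕ} {w : PointSum} (hw : realize w ∈ basisSpan m)
    (h : ∀ ns : List ℕ, BasisIndex (ns.map Int.negSucc) → ns.length = m →
      realize (formalMonomial (n :: ns)) ∈ basisSpan m') :
    realize (step n w) ∈ basisSpan m' := by
  obtain ⟨u, hu, huw⟩ := hw
  rw [← prod_frenkelJing_realize, ← huw, prod_frenkelJing_realize]
  have hle : Submodule.span QField (basisMonomials m) ≤
      (basisSpan m').comap (realize ∘ₗ step n) := by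
    rw [Submodule.span_le]
    rintro _ ⟨ns, hns, hlen, rfl⟩
    exact h ns hns hlen
  exact hle hu

/-- The two linear relations determine the terms with `i = 0, 1` by those with `i ≥ 2`. -/
theorem mem_of_relations {V : Type*} [AddCommGroup V] [Module QField V] {U : Submodule QField V}
    {M : ℕ} {f : ℕ → V} (h1 : ∑ i ∈ Finset.range (M + 2), f i = 0)
    (h2 : ∑ i ∈ Finset.range (M + 1), qNum qPar ((M + 1 - i : ℕ) : ℤ) • f i = 0)
    (hU : ∀ i, 2 ≤ i → f i ∈ U) : f 0 ∈ U ∧ f 1 ∈ U := by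
  -- Subtracting the second relation from `[M + 1]` times the first one eliminates `f 0`, and leaves
  -- `f 1` with the coefficient `[M + 1] - [M] = p ^ M`.
  have h1' := Finset.smul_sum (r := qNum qPar ((M + 1 : ℕ) : ℤ)) (s := Finset.range (M + 2))
    (f := f)
  rw [h1, smul_zero, Finset.sum_range_succ', Finset.sum_range_succ'] at h1'
  have h2' : ∑ i ∈ Finset.range (M + 2), qNum qPar ((M + 1 - i : ℕ) : ℤ) • f i = 0 := by
    rw [Finset.sum_range_succ, h2]
    simp [qNum]
  rw [Finset.sum_range_succ', Finset.sum_range_succ'] at h2'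
  rw [Finset.sum_range_succ', Finset.sum_range_succ'] at h1
  have hs1 : ∑ i ∈ Finset.range M, f (i + 1 + 1) ∈ U := sum_mem fun i _ => hU _ (by omega)
  have hs1' : ∑ i ∈ Finset.range M, qNum qPar ((M + 1 : ℕ) : ℤ) • f (i + 1 + 1) ∈ U :=
    sum_mem fun i _ => Submodule.smul_mem _ _ (hU _ (by omega))
  have hs2 : ∑ i ∈ Finset.range M, qNum qPar ((M + 1 - (i + 1 + 1) : ℕ) : ℤ) • f (i + 1 + 1) ∈ U :=
    sum_mem fun i _ => Submodule.smul_mem _ _ (hU _ (by omega))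
  have hc : qNum qPar ((M + 1 : ℕ) : ℤ) = qNum qPar (M : ℤ) + qPar ^ M := by
    rw [qNum_add qPar_ne_zero]
    have h0 := qPar_sub_one_ne_zero
    simp [qNum, h0]
  simp only [Nat.zero_add, Nat.sub_zero, Nat.add_sub_cancel] at h1 h1' h2'
  have hf1 : f 1 ∈ U := by
    have e : qPar ^ M • f 1 = ∑ i ∈ Finset.range M,
        qNum qPar ((M + 1 - (i + 1 + 1) : ℕ) : ℤ) • f (i + 1 + 1) -
        ∑ i ∈ Finset.range M, qNum qPar ((M + 1 : ℕ) : ℤ) • f (i + 1 + 1) := by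
      have h3 := add_right_cancel (h1'.symm.trans h2'.symm)
      have h4 : qNum qPar ((M + 1 : ℕ) : ℤ) • f 1 = qPar ^ M • f 1 + qNum qPar (M : ℤ) • f 1 := by
        rw [hc, add_smul, add_comm]
      rw [h4, ← add_assoc] at h3
      rw [eq_sub_iff_add_eq']
      exact add_right_cancel h3
    refine (Submodule.smul_mem_iff U (pow_ne_zero M qPar_ne_zero)).mp ?_
    rw [e]
    exact sub_mem hs2 hs1'
  refine ⟨?_, hf1⟩
  rw [eq_neg_of_add_eq_zero_right h1]
  exact neg_mem (add_mem hs1 hf1)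

/-- Every monomial is a linear combination of basis monomials of the same length. By induction the
tail may be assumed to be a basis monomial, and only the head has to be corrected. -/
theorem realize_formalMonomial_mem_basisSpan (ns : List ℕ) :
    realize (formalMonomial ns) ∈ basisSpan ns.length := by
  obtain ⟨m, hm⟩ : ∃ m, ns.length = m := ⟨_, rfl⟩
  induction m generalizing ns with
  | zero =>
    obtain rfl := List.length_eq_zero_iff.mp hm
    exact realize_formalMonomial_mem (ns := []) trivial
  | succ m ih =>
    obtain ⟨n, ns, rfl⟩ := List.exists_cons_of_length_eq_add_one hm
    rw [List.length_cons, add_left_inj] at hm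
    subst hm
    refine realize_step_mem (ih ns rfl) fun ns' hns' hlen => ?_
    rw [List.length_cons, ← hlen]
    cases ns' with
    | nil =>
      -- For `n = 0` the monomial is `x(z) 𝒴(z) = 0`.
      rcases Nat.eq_zero_or_pos n with rfl | hn
      · have h0 : realize (formalMonomial [0]) = 0 := by
          rw [formalMonomial, formalMonomial, step_single, map_smul, pow_zero,
            Module.End.one_apply, realize_single, List.map_nil, one_smul,
            pointProduct_cons_eq_zero (Or.inl rfl), smul_zero]
        rw [h0]
        exact zero_mem _
      · exact realize_formalMonomial_mem (ns := [n]) (basisIndex_singleton hn)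
    | cons n' t =>
      rcases Nat.lt_or_ge n 2 with hn | hn
      swap
      · exact realize_formalMonomial_mem (ns := n :: n' :: t) (basisIndex_cons hn hns')
      -- The relations trade an exponent `n ≤ 1` for exponents `i ≥ 2`; the new tails are covered by
      -- the induction hypothesis.
      have hlarge : ∀ i j, 2 ≤ i →
          realize (step i (step j (formalMonomial t))) ∈ basisSpan (t.length + 1 + 1) := by
        intro i j hi
        refine realize_step_mem (m := t.length + 1) (w := formalMonomial (j :: t))
          (ih (j :: t) (by rw [← hlen]; rfl)) fun ns'' h'' hlen'' => ?_
        rw [← hlen'']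
        exact realize_formalMonomial_mem (ns := i :: ns'') (basisIndex_cons hi h'')
      change realize (step n (step n' (formalMonomial t))) ∈ basisSpan (t.length + 1 + 1)
      have h1 := fun M => sum_realize_step_step M (formalMonomial t)
      have h2 := fun M => sum_qNum_smul_realize_step_step M (formalMonomial t)
      simp only [Finset.Nat.sum_antidiagonal_eq_sum_range_succ_mk] at h1 h2
      rcases Nat.eq_zero_or_pos (n + n') with hM | hM
      · obtain rfl : n = 0 := by omega
        obtain rfl : n' = 0 := by omega
        have h := h1 0
        rw [Finset.sum_range_one] at h
        rw [h]
        exact zero_mem _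
      · obtain ⟨M, hM⟩ : ∃ M, n + n' = M + 1 := ⟨n + n' - 1, by omega⟩
        have key := mem_of_relations (U := basisSpan (t.length + 1 + 1)) (M := M)
          (f := fun i => realize (step i (step (M + 1 - i) (formalMonomial t)))) (h1 (M + 1)) ?_
          fun i hi => hlarge _ _ hi
        · rcases Nat.eq_zero_or_pos n with rfl | hn0
          · have := key.1
            rwa [← hM, Nat.sub_zero, zero_add] at this
          · obtain rfl : n = 1 := by omega
            have := key.2
            rwa [← hM, Nat.add_sub_cancel_left] at this
        · rw [← h2 M]
          refine Finset.sum_congr rfl fun i hi => ?_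
          rw [Finset.mem_range] at hi
          rw [show M + 1 - i = M - i + 1 by omega]

theorem exists_map_negSucc {ls : List ℤ} (h : ∀ l ∈ ls, l ≤ -1) :
    ∃ ns : List ℕ, ls = ns.map Int.negSucc := by
  induction ls with
  | nil => exact ⟨[], rfl⟩
  | cons l ls ih =>
    obtain ⟨ns, rfl⟩ := ih fun l' hl' => h l' (List.mem_cons_of_mem _ hl')
    obtain ⟨n, rfl⟩ := Int.eq_negSucc_of_lt_zero
      (show l < 0 by have := h l List.mem_cons_self; omega)
    exact ⟨n :: ns, rfl⟩

theorem BasisIndex.le_neg_one {ls : List ℤ} (h : BasisIndex ls) : ∀ l ∈ ls, l ≤ -1 := by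
  induction ls with
  | nil => simp
  | cons l ls ih =>
    cases ls with
    | nil =>
      have h' : l ≤ -2 := h
      simpa using by omega
    | cons l' ls =>
      intro i hi
      rcases List.mem_cons.mp hi with rfl | hi
      · have := h.1; omega
      · exact ih h.2 i hi

theorem linearIndependent_koyamaMonomial :
    LinearIndependent QField fun ls : {ls : List ℤ // BasisIndex ls} => koyamaMonomial ls.1 := by
  choose f hf using fun ls : {ls : List ℤ // BasisIndex ls} => exists_map_negSucc ls.2.le_neg_one
  have h := linearIndependent_formalMonomial.comp
    (fun ls : {ls : List ℤ // BasisIndex ls} => ⟨f ls, by rw [← hf ls]; exact ls.2⟩) (by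
      intro ls ls' h
      have h' : f ls = f ls' := congrArg Subtype.val h
      exact Subtype.ext (by rw [hf ls, hf ls', h']))
  convert h using 1
  funext ls
  rw [Function.comp_apply, ← koyamaMonomial_map_negSucc, ← hf ls]

theorem span_koyamaMonomial :
    Submodule.span QField
      (Set.range fun ls : {ls : List ℤ // BasisIndex ls} => koyamaMonomial ls.1) = principalW1 := by
  refine le_antisymm (Submodule.span_mono ?_) (Submodule.span_le.mpr ?_)
  · rintro _ ⟨ls, rfl⟩
    exact ⟨ls.1, ls.2.le_neg_one, rfl⟩
  · rintro _ ⟨ls, hls, rfl⟩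
    obtain ⟨ns, rfl⟩ := exists_map_negSucc hls
    rw [koyamaMonomial_map_negSucc]
    refine (Submodule.map_span_le _ _ _).mpr ?_ (realize_formalMonomial_mem_basisSpan ns)
    rintro _ ⟨ns', hns', -, rfl⟩
    rw [← koyamaMonomial_map_negSucc]
    exact Submodule.subset_span ⟨⟨_, hns'⟩, rfl⟩

theorem principalW1_le_koyamaModule : principalW1 ≤ koyamaModule := by
  rw [principalW1, Submodule.span_le]
  rintro _ ⟨ls, -, rfl⟩
  refine Submodule.mem_sInf.mpr fun W hW => ?_
  have hx : frenkelJing 1 ∈ frenkelJingAlgebra 1 :=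
    Submodule.mem_sInf.mpr fun V hV => hV.2 (Set.mem_singleton _)
  induction ls with
  | nil => exact hW.2
  | cons l ls ih => exact hW.1.closed _ hx _ ih l

end QVA

end

theorem mainTheorem5 :
    QVA.principalW1 ≤ QVA.koyamaModule ∧
    ∃ b : Module.Basis {ls : List ℤ // QVA.BasisIndex ls} QVA.QField QVA.principalW1,
      ∀ ls : {ls : List ℤ // QVA.BasisIndex ls},
        (b ls : QVA.LaurentHom QVA.QField (QVA.FockSpace 0) (QVA.FockSpace 1)) =
          QVA.koyamaMonomial ls.1 := by
  refine ⟨QVA.principalW1_le_koyamaModule,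
    (Module.Basis.span QVA.linearIndependent_koyamaMonomial).map
      (LinearEquiv.ofEq _ _ QVA.span_koyamaMonomial), fun ls => ?_⟩
  rw [Module.Basis.map_apply, LinearEquiv.coe_ofEq_apply, Module.Basis.span_apply]
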